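/- Let $\mu,\nu$ be Borel probability measures on $\mathbb R$ with finite first moment, and let $q\in(0,1)$. Let $\mathrm{Marg}(\mu,\nu)$ be the set of Borel probability measures on $\mathbb R\times\mathbb R$ with first marginal $\mu$ and second marginal $\nu$. For $p>0$ put $T_p(\pi)=\iint|y-x|^p\,d\pi(x,y)\in[0,\infty]$, and let $\mathrm{Marg}^*_p(\mu,\nu)$ be the set of minimizers of $T_p$ on $\mathrm{Marg}(\mu,\nu)$. **Theorem.** For every $\pi\in\mathrm{Marg}(\mu,\nu)$ the following are equivalent. 1. There are $p_n\in(0,1)$ and $\pi_n\in\mathrm{Marg}^*_{p_n}(\mu,\nu)$, $n\in\mathbb N$, such that $p_n\to1$ and $\pi_n\to\pi$ weakly. 2. $\pi\in\mathrm{Marg}_1^*(\mu,\nu)$ and $T_q(\pi)\le T_q(\gamma)$ for every $\gamma\in\mathrm{Marg}_1^*(\mu,\nu)$. 3. $\pi$ is concentrated on a set $S\subset\mathbb R\times\mathbb R$ (that is, $\pi((\mathbb R\times\mathbb R)\setminus S)=0$) such that for all $(x,y),(x',y')\in S$, writing $[a,b]$ and $]a,b[$ for the closed and the open interval with end points $a$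 and $b$ in either order: * (arches do not cross) $[x,y]\cap[x',y']$ is empty or a single point, or one of the intervals $[x,y]$, $[x',y']$ is included in the other; * (arches do not connect) if $x\ne y$ and $x'\ne y'$, then $y\neq x'$; * (nested arches have the same orientation) if $[x',y']\subset\,]x,y[$, then $(y-x)(y'-x')\ge0$. 4. $\pi$ is the excursion coupling of $\mu$ and $\nu$, defined below. Moreover, there is exactly one $\pi\in\mathrm{Marg}(\mu,\nu)$ that satisfies these equivalent conditions. **Excursion coupling.** First let $\mu\perp\nu$, and put $F(x)=\mu(]-\infty,x])-\nu(]-\infty,x])$. Let $G$ be the completed graph of $F$: the set of $(x,h)\in\mathbb R^2$ such that $h$ lies in the closed interval with end points $F(x^-)$ and $F(x)$. Let $G^+$ (resp. $G^-$) be the set of $(x,h)\in G$ such that, for some neighbourhood $U$ of $x$, every $(x',h')\in G$ with $x'\in U\setminus\{x\}$ satisfies $(h'-h)(x'-x)>0$ (resp. $<0$). Let $\theta$ be the measure on $\mathbb R$ with density $i^\pm(h)=\mathrm{card}\{x:(x,h)\in G^+\}+\mathrm{card}\{x:(x,h)\in G^-\}$ with respect to Lebesgue measure, and let $H$ have law $\theta/2$.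 Write $\{x:(x,H)\in G\}=\{x_1<\dots<x_N\}$; almost surely this set is finite, with $N$ even. The excursion coupling of $\mu$ and $\nu$ is the law of $(X,Y)$, where, conditionally on $H$, the pair $(X,Y)$ is uniform on $\{(x_1,x_2),(x_3,x_4),\dots,(x_{N-1},x_N)\}$ if $H>0$, and on $\{(x_2,x_1),(x_4,x_3),\dots,(x_N,x_{N-1})\}$ if $H<0$. In general, write $\mu=\eta+\mu_0$ and $\nu=\eta+\nu_0$ with positive measures such that $\mu_0\perp\nu_0$, and let $m=\mu_0(\mathbb R)=\nu_0(\mathbb R)$. The excursion coupling of $\mu$ and $\nu$ is the image of $\eta$ under $x\mapsto(x,x)$ plus $m$ times the excursion coupling of $m^{-1}\mu_0$ and $m^{-1}\nu_0$ (the second term is absent if $m=0$). -/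

import Mathlib

open MeasureTheory Set Filter Topology
open scoped ENNReal

noncomputable section

/-! ### Transport plans on the real line and the power costs -/

/-- Transport plans from `μ` to `ν`: measures on `ℝ × ℝ` with first marginal `μ` and second
marginal `ν`. -/
def Marg (μ ν : Measure ℝ) : Set (Measure (ℝ × ℝ)) :=
  {π | π.map Prod.fst = μ ∧ π.map Prod.snd = ν}

/-- The cost `T_p(π) = ∬ |y - x| ^ p dπ(x, y)`, with values in `[0, ∞]`. -/
def transportCost (p : ℝ) (π : Measure (ℝ × ℝ)) : ℝ≥0∞ :=
  ∫⁻ z, ENNReal.ofReal (|z.2 - z.1| ^ p) ∂π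

/-- The solutions of the `L^p` transport problem from `μ` to `ν`. -/
def OptMarg (p : ℝ) (μ ν : Measure ℝ) : Set (Measure (ℝ × ℝ)) :=
  {π | π ∈ Marg μ ν ∧ ∀ γ ∈ Marg μ ν, transportCost p π ≤ transportCost p γ}

/-- Solutions of the `L^{1⁻}` limit transport problem: limits (for the weak topology) of solutions
of the `L^{p_n}` problems along some sequence `p_n < 1` that converges to `1`. -/
def IsLimitSolution (μ ν : Measure ℝ) (π : ProbabilityMeasure (ℝ × ℝ)) : Prop :=
  ∃ (πs : ℕ → ProbabilityMeasure (ℝ × ℝ)) (p : ℕ → ℝ),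
    (∀ n, 0 < p n ∧ p n < 1) ∧
    (∀ n, (πs n : Measure (ℝ × ℝ)) ∈ OptMarg (p n) μ ν) ∧
    Tendsto (fun n => (πs n, p n)) atTop (𝓝 (π, 1))

/-- Solutions of the `L^{1,q}` secondary transport problem. -/
def IsSecondarySolution (q : ℝ) (μ ν : Measure ℝ) (π : Measure (ℝ × ℝ)) : Prop :=
  π ∈ OptMarg 1 μ ν ∧ ∀ γ ∈ OptMarg 1 μ ν, transportCost q π ≤ transportCost q γ

/-! ### Sets of routes, seen as arches

`uIcc x y` is the segment `[min x y, max x y]` and `uIoo x y` is the open interval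
`(min x y, max x y)`. -/

/-- The arches of `S` do not cross. -/
def ArchesDoNotCross (S : Set (ℝ × ℝ)) : Prop :=
  ∀ x y x' y' : ℝ, (x, y) ∈ S → (x', y') ∈ S →
    uIcc x y ∩ uIcc x' y' = ∅ ∨ (∃ z, uIcc x y ∩ uIcc x' y' = {z}) ∨
      uIcc x y ⊆ uIcc x' y' ∨ uIcc x' y' ⊆ uIcc x y

/-- The arches of `S` do not connect. -/
def ArchesDoNotConnect (S : Set (ℝ × ℝ)) : Prop :=
  ∀ x y x' y' : ℝ, (x, y) ∈ S → (x', y') ∈ S → 0 < min |y - x| |y' - x'| → y ≠ x'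

/-- Nested arches of `S` have the same orientation. -/
def NestedArchesSameOrientation (S : Set (ℝ × ℝ)) : Prop :=
  ∀ x y x' y' : ℝ, (x, y) ∈ S → (x', y') ∈ S → uIcc x' y' ⊆ uIoo x y →
    0 ≤ (y - x) * (y' - x')

/-- The plan `π` is concentrated on a set of routes whose arches do not cross, do not connect, and
have the same orientation when they are nested. -/
def IsMonotonePlan (π : Measure (ℝ × ℝ)) : Prop :=
  ∃ S : Set (ℝ × ℝ), π Sᶜ = 0 ∧ ArchesDoNotCross S ∧ ArchesDoNotConnect S ∧
    NestedArchesSameOrientation S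

/-! ### The excursion coupling -/

/-- The cumulative distribution function `F_σ` of the signed measure `σ = μ - ν`. -/
def diffCDF (μ ν : Measure ℝ) (x : ℝ) : ℝ := μ.real (Iic x) - ν.real (Iic x)

/-- The completed graph of `F`: the graph, together with the vertical segment between `F (x⁻)` and
`F x` over each point `x`. -/
def completedGraph (F : ℝ → ℝ) : Set (ℝ × ℝ) :=
  {z | z.2 ∈ uIcc (Function.leftLim F z.1) (F z.1)}

/-- The increasing points of the completed graph. -/
def increasingPoints (F : ℝ → ℝ) : Set (ℝ × ℝ) :=
  {z ∈ completedGraph F | ∃ U ∈ 𝓝 z.1, ∀ z' ∈ completedGraph F,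
    z'.1 ∈ U \ {z.1} → 0 < (z'.2 - z.2) * (z'.1 - z.1)}

/-- The decreasing points of the completed graph. -/
def decreasingPoints (F : ℝ → ℝ) : Set (ℝ × ℝ) :=
  {z ∈ completedGraph F | ∃ U ∈ 𝓝 z.1, ∀ z' ∈ completedGraph F,
    z'.1 ∈ U \ {z.1} → (z'.2 - z.2) * (z'.1 - z.1) < 0}

/-- The horizontal line at height `h`. -/
def horizontalLine (h : ℝ) : Set (ℝ × ℝ) := univ ×ˢ {h}

/-- The number `i^±(h)` of increasing and decreasing points at height `h`. -/
def crossingCount (F : ℝ → ℝ) (h : ℝ) : ℝ≥0∞ :=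
  ((horizontalLine h ∩ increasingPoints F).encard : ℝ≥0∞) +
    ((horizontalLine h ∩ decreasingPoints F).encard : ℝ≥0∞)

/-- The pairs `(x₁, x₂), (x₃, x₄), …` of consecutive generalized solutions
`x₁ < x₂ < ⋯ < x_N` of `F = h` (with the enumeration starting at the index `0` in the code). -/
def excursionPairs (F : ℝ → ℝ) (h : ℝ) : Set (ℝ × ℝ) :=
  {z | ∃ (N : ℕ) (x : Fin N → ℝ), StrictMono x ∧
    horizontalLine h ∩ completedGraph F = range x ×ˢ {h} ∧
    ∃ (k : ℕ) (hk : 2 * k + 1 < N), z = (x ⟨2 * k, by omega⟩, x ⟨2 * k + 1, hk⟩)}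

/-- The routes attached to the height `h`: `(x₁, x₂), (x₃, x₄), …` if `h > 0`, and
`(x₂, x₁), (x₄, x₃), …` if `h < 0`. (The height `0` carries no mass.) -/
def excursionRoutes (F : ℝ → ℝ) (h : ℝ) : Set (ℝ × ℝ) :=
  {z | 0 < h ∧ z ∈ excursionPairs F h ∨ h < 0 ∧ z.swap ∈ excursionPairs F h}

/-- The excursion coupling of two mutually singular probability measures: the law of `(X, Y)`,
where `H` has law `θ / 2`, `θ` has density `i^±` with respect to Lebesgue measure, and
conditionally on `H` the pair `(X, Y)` is uniform on the routes attached to the height `H`. -/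
def singularExcursionCoupling (μ ν : Measure ℝ) : Measure (ℝ × ℝ) :=
  ((2 : ℝ≥0∞)⁻¹ • (volume : Measure ℝ).withDensity (crossingCount (diffCDF μ ν))).bind
    (fun h => ProbabilityTheory.uniformOn (excursionRoutes (diffCDF μ ν) h))

/-- `π` is the excursion coupling of `μ` and `ν`: write `μ = η + μ₀` and `ν = η + ν₀` with
`μ₀ ⟂ ν₀`; the mass `η` stays in place, and the remaining mass is moved according to the excursion
coupling of the normalized singular parts. -/
def IsExcursionCoupling (μ ν : Measure ℝ) (π : Measure (ℝ × ℝ)) : Prop :=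
  ∃ η μ₀ ν₀ : Measure ℝ, μ = η + μ₀ ∧ ν = η + ν₀ ∧ μ₀ ⟂ₘ ν₀ ∧
    π = η.map (fun x => (x, x)) +
      μ₀ univ • singularExcursionCoupling ((μ₀ univ)⁻¹ • μ₀) ((ν₀ univ)⁻¹ • ν₀)

end

/-! ### Power costs -/

/-! Only 1 → 3, 2 → 3 and 3 → 4 are proved directly. Compactness provides one limit solution and one
secondary solution; both are monotone plans, hence excursion couplings. The excursion coupling is
unique (`IsExcursionCoupling.unique`), because μ - ν has only one Jordan decomposition. So any plan
satisfying 4 equals those two solutions, which gives 4 → 1 and 4 → 2. Neither the marginals nor the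
monotonicity of the excursion coupling has to be checked from its definition.

Monotonicity rests on `exists_exchange`: if exchanging the targets of the routes in A and in B
always lowers the cost, an optimal plan cannot charge both. For p = 1 this forbids opposite routes
that overlap. Two crossing routes with the same direction tie for p = 1, and strict concavity of t ^
p for p < 1 decides against them. Both conditions are open, so they hold on the support and survive
weak limits. Connecting arches are not an open condition in the limit. There, the optimal plans for
p < 1 all fix the same common part η of μ and ν; the limit keeps it fixed, and moves the rest
between mutually singular measures, which share no atom.

For 3 → 4, write F for the difference of the distribution functions. In a plan without crossing,
connecting or opposite overlapping arches, the mass passing rightwards over [a, b] is the positive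
part of the infimum of F on [a, b] (`measure_Iic_prod_Ioi`). On the other side, for almost every h >
0 the level h is crossed finitely often, with F alternately below and above h. The segment [a, b] is
then straddled by exactly one excursion above h if h is less than this infimum, and by none if h is
greater. Integrating over h gives the same number. Quadrants determine a measure on the rightward
routes, and the leftward routes follow by swapping μ and ν, that is F and -F. -/

lemma measurable_powCost (p : ℝ) :
    Measurable (fun z : ℝ × ℝ => ENNReal.ofReal (|z.2 - z.1| ^ p)) := by
  fun_prop

lemma continuous_powCost {p : ℝ} (hp : 0 < p) :
    Continuous (fun z : ℝ × ℝ => |z.2 - z.1| ^ p) :=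
  Continuous.rpow_const (by fun_prop) fun _ => Or.inr hp.le

lemma isProbabilityMeasure_of_mem_marg {μ ν : Measure ℝ} [IsProbabilityMeasure μ]
    {π : Measure (ℝ × ℝ)} (hπ : π ∈ Marg μ ν) : IsProbabilityMeasure π := by
  constructor
  rw [← preimage_univ (f := Prod.fst), ← Measure.map_apply measurable_fst MeasurableSet.univ, hπ.1]
  exact measure_univ

lemma lintegral_abs_ne_top {μ : Measure ℝ} (hμ : Integrable (fun x : ℝ => |x|) μ) :
    ∫⁻ x, ENNReal.ofReal |x| ∂μ ≠ ∞ := by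
  have h := hμ.2
  rw [hasFiniteIntegral_iff_ofReal (ae_of_all _ fun x => abs_nonneg x)] at h
  exact h.ne

/-- The bound |y - x| ^ p ≤ 1 + |x| + |y| reduces this to first moments. Finiteness is what makes a
strict gain on part of a plan a strict gain in total cost. -/
lemma transportCost_ne_top {μ ν : Measure ℝ} [IsProbabilityMeasure μ]
    (hμ : Integrable (fun x : ℝ => |x|) μ) (hν : Integrable (fun x : ℝ => |x|) ν)
    {p : ℝ} (hp : 0 < p) (hp1 : p ≤ 1) {π : Measure (ℝ × ℝ)} (hπ : π ∈ Marg μ ν) :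
    transportCost p π ≠ ∞ := by
  have := isProbabilityMeasure_of_mem_marg hπ
  have hle : transportCost p π ≤
      ∫⁻ z, (1 + (ENNReal.ofReal |z.1| + ENNReal.ofReal |z.2|)) ∂π := by
    refine lintegral_mono fun z => ?_
    rw [← ENNReal.ofReal_add (abs_nonneg _) (abs_nonneg _), ← ENNReal.ofReal_one,
      ← ENNReal.ofReal_add zero_le_one (by positivity)]
    refine ENNReal.ofReal_le_ofReal ?_
    have h1 : |z.2 - z.1| ≤ |z.1| + |z.2| := by
      rw [add_comm]; exact abs_sub _ _
    rcases le_total |z.2 - z.1| 1 with h | h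
    · have := Real.rpow_le_one (abs_nonneg (z.2 - z.1)) h hp.le
      have := abs_nonneg z.1
      have := abs_nonneg z.2
      linarith
    · have := Real.rpow_le_rpow_of_exponent_le h hp1
      rw [Real.rpow_one] at this
      linarith
  refine ne_top_of_le_ne_top ?_ hle
  rw [lintegral_add_left measurable_const, lintegral_add_left (by fun_prop)]
  have e1 : ∫⁻ z, ENNReal.ofReal |z.1| ∂π = ∫⁻ x, ENNReal.ofReal |x| ∂μ := by
    rw [← hπ.1, lintegral_map (by fun_prop) measurable_fst]
  have e2 : ∫⁻ z, ENNReal.ofReal |z.2| ∂π = ∫⁻ x, ENNReal.ofReal |x| ∂ν := by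
    rw [← hπ.2, lintegral_map (by fun_prop) measurable_snd]
  rw [e1, e2]
  simp [lintegral_abs_ne_top hμ, lintegral_abs_ne_top hν]

/-! ### Exchanging targets -/

/-- Exchange the targets of the routes in `A` and of those in `B`. -/
theorem exists_exchange {μ ν : Measure ℝ} [IsProbabilityMeasure μ] {π : Measure (ℝ × ℝ)}
    (hπ : π ∈ Marg μ ν) {A B : Set (ℝ × ℝ)} (hA : MeasurableSet A) (hB : MeasurableSet B) :
    ∃ γ ∈ Marg μ ν, ∀ p : ℝ,
      ((∀ z ∈ A, ∀ z' ∈ B, |z'.2 - z.1| ^ p + |z.2 - z'.1| ^ p ≤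
        |z.2 - z.1| ^ p + |z'.2 - z'.1| ^ p) → transportCost p γ ≤ transportCost p π) ∧
      ((∀ z ∈ A, ∀ z' ∈ B, |z'.2 - z.1| ^ p + |z.2 - z'.1| ^ p <
        |z.2 - z.1| ^ p + |z'.2 - z'.1| ^ p) → π A ≠ 0 → π B ≠ 0 → transportCost p π ≠ ∞ →
        transportCost p γ < transportCost p π) := by
  have := isProbabilityMeasure_of_mem_marg hπ
  -- Every route in A is paired with every route in B. Both marginals of `P` are at most π, since
  -- the masses of A and B are at most 1, so half of their sum can be removed from π and put back
  -- with exchanged targets.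
  set P := (π.restrict A).prod (π.restrict B) with hP
  set α := P.map Prod.fst
  set β := P.map Prod.snd
  have hle : (2 : ℝ≥0∞)⁻¹ • (α + β) ≤ π := by
    have h1 : α ≤ π := by
      simp only [α, hP, Measure.map_fst_prod]
      refine Measure.le_iff.2 fun s _ => ?_
      rw [Measure.smul_apply, smul_eq_mul]
      calc _ ≤ 1 * π s := mul_le_mul' ((Measure.restrict_apply_le B univ).trans prob_le_one)
            (Measure.restrict_apply_le A s)
        _ = _ := one_mul _
    have h2 : β ≤ π := by
      simp only [β, hP, Measure.map_snd_prod]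
      refine Measure.le_iff.2 fun s _ => ?_
      rw [Measure.smul_apply, smul_eq_mul]
      calc _ ≤ 1 * π s := mul_le_mul' ((Measure.restrict_apply_le A univ).trans prob_le_one)
            (Measure.restrict_apply_le B s)
        _ = _ := one_mul _
    refine Measure.le_iff.2 fun s _ => ?_
    rw [Measure.smul_apply, smul_eq_mul, Measure.add_apply]
    calc _ ≤ (2 : ℝ≥0∞)⁻¹ * (π s + π s) := mul_le_mul_right (add_le_add (h1 s) (h2 s)) _
      _ = π s := by
        rw [← two_mul, ← mul_assoc, ENNReal.inv_mul_cancel (by simp) (by simp), one_mul]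
  have : IsFiniteMeasure ((2 : ℝ≥0∞)⁻¹ • (α + β)) := isFiniteMeasure_of_le π hle
  set ρ := π - (2 : ℝ≥0∞)⁻¹ • (α + β)
  have hρ : ρ + (2 : ℝ≥0∞)⁻¹ • (α + β) = π := Measure.sub_add_cancel_of_le hle
  have m1 : Measurable (fun w : (ℝ × ℝ) × (ℝ × ℝ) => (w.1.1, w.2.2)) := by fun_prop
  have m2 : Measurable (fun w : (ℝ × ℝ) × (ℝ × ℝ) => (w.2.1, w.1.2)) := by fun_prop
  set γ := ρ + (2 : ℝ≥0∞)⁻¹ • (P.map (fun w => (w.1.1, w.2.2)) + P.map (fun w => (w.2.1, w.1.2)))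
    with hγ
  have hcost : ∀ p, transportCost p π = transportCost p ρ + (2 : ℝ≥0∞)⁻¹ *
      ∫⁻ w, ENNReal.ofReal (|w.1.2 - w.1.1| ^ p + |w.2.2 - w.2.1| ^ p) ∂P := by
    intro p
    conv_lhs => rw [← hρ]
    simp only [transportCost]
    rw [lintegral_add_measure, lintegral_smul_measure, lintegral_add_measure,
      lintegral_map (measurable_powCost p) measurable_fst,
      lintegral_map (measurable_powCost p) measurable_snd, smul_eq_mul,
      ← lintegral_add_left (by fun_prop)]
    simp_rw [← ENNReal.ofReal_add (Real.rpow_nonneg (abs_nonneg _) p)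
      (Real.rpow_nonneg (abs_nonneg _) p)]
  have hcost' : ∀ p, transportCost p γ = transportCost p ρ + (2 : ℝ≥0∞)⁻¹ *
      ∫⁻ w, ENNReal.ofReal (|w.2.2 - w.1.1| ^ p + |w.1.2 - w.2.1| ^ p) ∂P := by
    intro p
    simp only [transportCost, hγ]
    rw [lintegral_add_measure, lintegral_smul_measure, lintegral_add_measure,
      lintegral_map (measurable_powCost p) m1,
      lintegral_map (measurable_powCost p) m2, smul_eq_mul,
      ← lintegral_add_left (by fun_prop)]
    simp_rw [← ENNReal.ofReal_add (Real.rpow_nonneg (abs_nonneg _) p)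
      (Real.rpow_nonneg (abs_nonneg _) p)]
  have hPAB : ∀ᵐ w ∂P, w.1 ∈ A ∧ w.2 ∈ B := by
    rw [hP, Measure.prod_restrict]
    exact ae_restrict_mem (hA.prod hB)
  refine ⟨γ, ⟨?_, ?_⟩, fun p => ⟨fun h => ?_, fun h hA0 hB0 hfin => ?_⟩⟩
  · rw [← hπ.1]
    conv_rhs => rw [← hρ]
    simp only [hγ, Measure.map_add _ _ measurable_fst, Measure.map_smul, α, β,
      Measure.map_map measurable_fst m1, Measure.map_map measurable_fst m2,
      Measure.map_map measurable_fst measurable_fst, Measure.map_map measurable_fst measurable_snd]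
    rfl
  · rw [← hπ.2]
    conv_rhs => rw [← hρ]
    simp only [hγ, Measure.map_add _ _ measurable_snd, Measure.map_smul, α, β,
      Measure.map_map measurable_snd m1, Measure.map_map measurable_snd m2,
      Measure.map_map measurable_snd measurable_fst, Measure.map_map measurable_snd measurable_snd]
    rw [add_comm (P.map _)]
    rfl
  · rw [hcost, hcost']
    exact add_le_add_right (mul_le_mul_right (lintegral_mono_ae
      (hPAB.mono fun w hw => ENNReal.ofReal_le_ofReal (h _ hw.1 _ hw.2))) _) _
  · rw [hcost, hcost'] at *
    have h1 : transportCost p ρ ≠ ∞ := fun e => hfin (by simp [e])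
    have h2 : ∫⁻ w, ENNReal.ofReal (|w.1.2 - w.1.1| ^ p + |w.2.2 - w.2.1| ^ p) ∂P ≠ ∞ :=
      fun e => hfin (by rw [e]; simp)
    have hP0 : P ≠ 0 := by
      intro e
      have : P (A ×ˢ B) = 0 := by simp [e]
      rw [hP, Measure.prod_prod, Measure.restrict_apply_self, Measure.restrict_apply_self] at this
      exact (mul_ne_zero hA0 hB0) this
    have hlt : ∀ᵐ w ∂P, ENNReal.ofReal (|w.2.2 - w.1.1| ^ p + |w.1.2 - w.2.1| ^ p) <
        ENNReal.ofReal (|w.1.2 - w.1.1| ^ p + |w.2.2 - w.2.1| ^ p) :=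
      hPAB.mono fun w hw => (ENNReal.ofReal_lt_ofReal_iff_of_nonneg
        (by positivity)).2 (h _ hw.1 _ hw.2)
    refine ENNReal.add_lt_add_left h1 ?_
    refine ENNReal.mul_lt_mul_right (by simp) (by simp) ?_
    exact lintegral_strict_mono hP0 (by fun_prop)
      (ne_top_of_le_ne_top h2 (lintegral_mono_ae (hlt.mono fun _ => le_of_lt))) hlt

/-! ### Existence of solutions -/

/-- The transport plans, as a set of probability measures. -/
def probMarg (μ ν : Measure ℝ) : Set (ProbabilityMeasure (ℝ × ℝ)) :=
  {π | (π : Measure (ℝ × ℝ)) ∈ Marg μ ν}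

lemma isClosed_probMarg (μ ν : Measure ℝ) [IsProbabilityMeasure μ] [IsProbabilityMeasure ν] :
    IsClosed (probMarg μ ν) := by
  have e : probMarg μ ν =
      (fun π : ProbabilityMeasure (ℝ × ℝ) => π.map measurable_fst.aemeasurable) ⁻¹'
        {(⟨μ, inferInstance⟩ : ProbabilityMeasure ℝ)} ∩
      (fun π : ProbabilityMeasure (ℝ × ℝ) => π.map measurable_snd.aemeasurable) ⁻¹'
        {(⟨ν, inferInstance⟩ : ProbabilityMeasure ℝ)} := by
    ext π
    exact and_congr (Subtype.ext_iff (a1 := π.map measurable_fst.aemeasurable)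
      (a2 := (⟨μ, inferInstance⟩ : ProbabilityMeasure ℝ))).symm
      (Subtype.ext_iff (a1 := π.map measurable_snd.aemeasurable)
      (a2 := (⟨ν, inferInstance⟩ : ProbabilityMeasure ℝ))).symm
  rw [e]
  exact (isClosed_singleton.preimage (ProbabilityMeasure.continuous_map continuous_fst)).inter
    (isClosed_singleton.preimage (ProbabilityMeasure.continuous_map continuous_snd))

/-- Prokhorov: tightness of the two marginals gives uniform tightness of the plans. -/
lemma isCompact_probMarg (μ ν : Measure ℝ) [IsProbabilityMeasure μ] [IsProbabilityMeasure ν] :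
    IsCompact (probMarg μ ν) := by
  rw [← (isClosed_probMarg μ ν).closure_eq]
  refine isCompact_closure_of_isTightMeasureSet ?_
  rw [isTightMeasureSet_iff_exists_isCompact_measure_compl_le]
  intro ε hε
  obtain ⟨K, hK, hKμ⟩ := isTightMeasureSet_iff_exists_isCompact_measure_compl_le.1
    (isTightMeasureSet_singleton (μ := μ)) (ε / 2) (ENNReal.half_pos hε.ne')
  obtain ⟨M, hM, hMν⟩ := isTightMeasureSet_iff_exists_isCompact_measure_compl_le.1
    (isTightMeasureSet_singleton (μ := ν)) (ε / 2) (ENNReal.half_pos hε.ne')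
  refine ⟨K ×ˢ M, hK.prod hM, ?_⟩
  rintro _ ⟨π, hπ, rfl⟩
  have h1 := hKμ μ rfl
  have h2 := hMν ν rfl
  rw [← hπ.1, Measure.map_apply measurable_fst hK.measurableSet.compl] at h1
  rw [← hπ.2, Measure.map_apply measurable_snd hM.measurableSet.compl] at h2
  rw [compl_prod_eq_union]
  calc _ ≤ _ := measure_union_le _ _
    _ ≤ ε / 2 + ε / 2 := by
      refine add_le_add ?_ ?_
      · rwa [prod_univ]
      · rwa [univ_prod]
    _ = ε := ENNReal.add_halves ε

lemma probMarg_nonempty (μ ν : Measure ℝ) [IsProbabilityMeasure μ] [IsProbabilityMeasure ν] :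
    (probMarg μ ν).Nonempty :=
  ⟨⟨μ.prod ν, inferInstance⟩, by
    change _ ∧ _
    simp [Measure.map_fst_prod, Measure.map_snd_prod]⟩

lemma lowerSemicontinuous_transportCost {p : ℝ} (hp : 0 < p) :
    LowerSemicontinuous (fun π : ProbabilityMeasure (ℝ × ℝ) =>
      transportCost p (π : Measure (ℝ × ℝ))) := by
  rw [lowerSemicontinuous_iff_isClosed_preimage]
  intro c
  refine IsSeqClosed.isClosed fun πs π h hlim => ?_
  have h1 := lintegral_le_liminf_lintegral_of_forall_isOpen_measure_le_liminf_measure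
    (continuous_powCost hp) (fun z => Real.rpow_nonneg (abs_nonneg _) p)
    (fun G hG => ProbabilityMeasure.le_liminf_measure_open_of_tendsto hlim hG)
  refine h1.trans ?_
  refine liminf_le_of_frequently_le' (Frequently.of_forall fun n => h n)

lemma exists_mem_optMarg {μ ν : Measure ℝ} [IsProbabilityMeasure μ] [IsProbabilityMeasure ν]
    {p : ℝ} (hp : 0 < p) :
    ∃ π : ProbabilityMeasure (ℝ × ℝ), (π : Measure (ℝ × ℝ)) ∈ OptMarg p μ ν := by
  obtain ⟨π, hπ, hmin⟩ := LowerSemicontinuousOn.exists_isMinOn (probMarg_nonempty μ ν)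
    (isCompact_probMarg μ ν) ((lowerSemicontinuous_transportCost hp).lowerSemicontinuousOn _)
  refine ⟨π, hπ, fun γ hγ => ?_⟩
  have := isProbabilityMeasure_of_mem_marg hγ
  exact hmin (a := ⟨γ, this⟩) hγ

lemma exists_isSecondarySolution {μ ν : Measure ℝ} [IsProbabilityMeasure μ]
    [IsProbabilityMeasure ν] {q : ℝ} (hq : 0 < q) :
    ∃ π : ProbabilityMeasure (ℝ × ℝ), IsSecondarySolution q μ ν (π : Measure (ℝ × ℝ)) := by
  -- The optimal plans for p = 1 form a sublevel set of a lower semicontinuous cost, hence a compact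
  -- set on which the cost for q can be minimized.
  obtain ⟨π₀, h₀, hmin⟩ := exists_mem_optMarg (μ := μ) (ν := ν) zero_lt_one
  set K := probMarg μ ν ∩ {π : ProbabilityMeasure (ℝ × ℝ) |
    transportCost 1 (π : Measure (ℝ × ℝ)) ≤ transportCost 1 (π₀ : Measure (ℝ × ℝ))}
  have hK : IsCompact K := (isCompact_probMarg μ ν).inter_right
    ((lowerSemicontinuous_transportCost zero_lt_one).isClosed_preimage _)
  obtain ⟨π, hπ, hπmin⟩ := LowerSemicontinuousOn.exists_isMinOn (s := K) ⟨π₀, h₀, le_refl (transportCost 1 _)⟩ hK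
    ((lowerSemicontinuous_transportCost hq).lowerSemicontinuousOn _)
  refine ⟨π, ⟨hπ.1, fun γ hγ => hπ.2.trans (hmin γ hγ)⟩, fun γ hγ => ?_⟩
  have := isProbabilityMeasure_of_mem_marg hγ.1
  exact hπmin (a := ⟨γ, this⟩) ⟨hγ.1, hγ.2 _ h₀⟩

lemma exists_isLimitSolution {μ ν : Measure ℝ} [IsProbabilityMeasure μ]
    [IsProbabilityMeasure ν] :
    ∃ π ∈ probMarg μ ν, IsLimitSolution μ ν π := by
  -- The shift by 2 keeps `p 0` positive.
  set p : ℕ → ℝ := fun n => 1 - 1 / ((n : ℝ) + 2) with hp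
  have hp01 : ∀ n, 0 < p n ∧ p n < 1 := by
    intro n
    have h2 : (0 : ℝ) < (n : ℝ) + 2 := by positivity
    have h3 : 1 / ((n : ℝ) + 2) < 1 := by
      rw [div_lt_one h2]; linarith [(Nat.cast_nonneg n : (0 : ℝ) ≤ n)]
    have h4 : 0 < 1 / ((n : ℝ) + 2) := by positivity
    exact ⟨by simp only [hp]; linarith, by simp only [hp]; linarith⟩
  have hplim : Tendsto p atTop (𝓝 1) := by
    have h : Tendsto (fun n : ℕ => 1 / ((n : ℝ) + 2)) atTop (𝓝 0) :=
      Tendsto.const_div_atTop (tendsto_natCast_atTop_atTop.atTop_add tendsto_const_nhds) 1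
    simpa [hp] using h.const_sub 1
  choose πs hπs using fun n => exists_mem_optMarg (μ := μ) (ν := ν) (hp01 n).1
  obtain ⟨π, hπ, φ, hφ, hlim⟩ := (isCompact_probMarg μ ν).tendsto_subseq fun n => (hπs n).1
  refine ⟨π, hπ, πs ∘ φ, p ∘ φ, fun n => hp01 _, fun n => hπs _, ?_⟩
  exact hlim.prodMk_nhds (hplim.comp hφ.tendsto_atTop)

/-! ### From local inequalities to monotone plans -/

/-- Pairs of routes of `T` cannot be improved for the cost `|y - x|`. -/
def PairwiseOptimal (T : Set (ℝ × ℝ)) : Prop :=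
  ∀ z ∈ T, ∀ z' ∈ T, |z.2 - z.1| + |z'.2 - z'.1| ≤ |z'.2 - z.1| + |z.2 - z'.1|

/-- No two rightward arches of `T` cross. -/
def NoRightwardCrossing (T : Set (ℝ × ℝ)) : Prop :=
  ∀ z ∈ T, ∀ z' ∈ T, z.1 < z'.1 → z'.1 < z.2 → z.2 < z'.2 → False

/-- The routes that enter `c`. -/
def routesInto (c : ℝ) : Set (ℝ × ℝ) := {w | w.2 = c ∧ w.1 ≠ c}

/-- The routes that leave `c`. -/
def routesFrom (c : ℝ) : Set (ℝ × ℝ) := {w | w.1 = c ∧ w.2 ≠ c}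

lemma measurableSet_routesInto (c : ℝ) : MeasurableSet (routesInto c) :=
  (measurableSet_eq_fun measurable_snd measurable_const).inter
    (measurableSet_eq_fun measurable_fst measurable_const).compl

lemma measurableSet_routesFrom (c : ℝ) : MeasurableSet (routesFrom c) :=
  (measurableSet_eq_fun measurable_fst measurable_const).inter
    (measurableSet_eq_fun measurable_snd measurable_const).compl

/-- The overlap of the two segments is travelled once in each direction; exchanging the targets
saves twice its length. -/
lemma PairwiseOptimal.opposite {T : Set (ℝ × ℝ)} (hT : PairwiseOptimal T) {x y x' y' : ℝ}
    (h : (x, y) ∈ T) (h' : (x', y') ∈ T) (h1 : x < y) (h2 : y' < x') (h3 : y' < y)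
    (h4 : x < x') : False := by
  have := hT _ h _ h'
  simp only at this
  rw [abs_of_pos (sub_pos.2 h1), abs_of_neg (sub_neg.2 h2)] at this
  rcases abs_cases (y' - x) with h5 | h5 <;> rcases abs_cases (y - x') with h6 | h6 <;> linarith

lemma Icc_inter_Icc_cases {l r l' r' : ℝ} (h1 : l < l' → l' < r → r < r' → False)
    (h2 : l' < l → l < r' → r' < r → False) :
    Icc l r ∩ Icc l' r' = ∅ ∨ (∃ z, Icc l r ∩ Icc l' r' = {z}) ∨
      Icc l r ⊆ Icc l' r' ∨ Icc l' r' ⊆ Icc l r := by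
  have key : ∀ {l r l' r' : ℝ}, l < l' → (l < l' → l' < r → r < r' → False) →
      Icc l r ∩ Icc l' r' = ∅ ∨ (∃ z, Icc l r ∩ Icc l' r' = {z}) ∨
      Icc l' r' ⊆ Icc l r := by
    intro l r l' r' hl h
    by_cases hr : r' ≤ r
    · exact Or.inr (Or.inr (Icc_subset_Icc hl.le hr))
    · rcases lt_trichotomy r l' with h3 | h3 | h3
      · left
        rw [Icc_inter_Icc, Icc_eq_empty]
        rw [not_le]
        exact (inf_le_left.trans_lt h3).trans_le le_sup_right
      · right; left
        refine ⟨r, ?_⟩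
        rw [Icc_inter_Icc, sup_eq_right.2 hl.le, inf_eq_left.2 (not_le.1 hr).le, h3, Icc_self]
      · exact (h hl h3 (not_le.1 hr)).elim
  rcases lt_trichotomy l l' with h | h | h
  · rcases key h h1 with h | h | h
    · exact Or.inl h
    · exact Or.inr (Or.inl h)
    · exact Or.inr (Or.inr (Or.inr h))
  · subst h
    rcases le_total r r' with h | h
    · exact Or.inr (Or.inr (Or.inl (Icc_subset_Icc_right h)))
    · exact Or.inr (Or.inr (Or.inr (Icc_subset_Icc_right h)))
  · rcases key h h2 with h | h | h
    · exact Or.inl (by rwa [inter_comm])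
    · exact Or.inr (Or.inl (by rwa [inter_comm]))
    · exact Or.inr (Or.inr (Or.inl h))

/-- Crossing arches with opposite orientations overlap, which pairwise optimality excludes. Those
with equal orientations are the two remaining hypotheses. -/
lemma archesDoNotCross_of_pairwiseOptimal {T : Set (ℝ × ℝ)} (h1 : PairwiseOptimal T)
    (h2 : NoRightwardCrossing T) (h3 : NoRightwardCrossing (Prod.swap ⁻¹' T)) :
    ArchesDoNotCross T := by
  have key : ∀ x y x' y' : ℝ, (x, y) ∈ T → (x', y') ∈ T → min x y < min x' y' →
      min x' y' < max x y → max x y < max x' y' → False := by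
    intro x y x' y' h h' c1 c2 c3
    rcases le_total x y with hx | hx <;> rcases le_total x' y' with hx' | hx' <;>
      simp only [min_eq_left hx, min_eq_right hx, min_eq_left hx', min_eq_right hx',
        max_eq_left hx, max_eq_right hx, max_eq_left hx', max_eq_right hx'] at c1 c2 c3
    · exact h2 _ h _ h' c1 c2 c3
    · exact h1.opposite h h' (c1.trans c2) (c2.trans c3) c2 (by linarith)
    · exact h1.opposite h' h (c2.trans c3) (c1.trans c2) (by linarith) c2
    · exact h3 (y, x) h (y', x') h' c1 c2 c3
  intro x y x' y' h h'
  exact Icc_inter_Icc_cases (key x y x' y' h h') (key x' y' x y h' h)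

lemma nestedArchesSameOrientation_of_pairwiseOptimal {T : Set (ℝ × ℝ)} (h1 : PairwiseOptimal T) :
    NestedArchesSameOrientation T := by
  intro x y x' y' h h' hsub
  by_contra hneg
  push Not at hneg
  have hx' := hsub left_mem_uIcc
  have hy' := hsub right_mem_uIcc
  rcases mul_neg_iff.1 hneg with ⟨ha, hb⟩ | ⟨ha, hb⟩
  · rw [uIoo_of_lt (sub_pos.1 ha)] at hx' hy'
    exact h1.opposite h h' (sub_pos.1 ha) (sub_neg.1 hb) hy'.2 hx'.1
  · rw [uIoo_of_gt (sub_neg.1 ha)] at hx' hy'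
    exact h1.opposite h' h (sub_pos.1 hb) (sub_neg.1 ha) hy'.1 hx'.2

/-- Attach to c two rationals, one under the arch that arrives and one under the arch that leaves.
If c < c' had the same rationals, the arch arriving at c' and the arch leaving c would cross. -/
lemma countable_rightward_connections {T : Set (ℝ × ℝ)} (h2 : NoRightwardCrossing T) :
    {c | ∃ x y, (x, c) ∈ T ∧ (c, y) ∈ T ∧ x < c ∧ c < y}.Countable := by
  have hch : ∀ c ∈ {c | ∃ x y, (x, c) ∈ T ∧ (c, y) ∈ T ∧ x < c ∧ c < y},
      ∃ r : ℚ × ℚ, ∃ x y, (x, c) ∈ T ∧ (c, y) ∈ T ∧ x < r.1 ∧ (r.1 : ℝ) < c ∧ c < r.2 ∧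
        (r.2 : ℝ) < y := by
    rintro c ⟨x, y, hx, hy, hxc, hcy⟩
    obtain ⟨r, h1, h2⟩ := exists_rat_btwn hxc
    obtain ⟨s, h3, h4⟩ := exists_rat_btwn hcy
    exact ⟨(r, s), x, y, hx, hy, h1, h2, h3, h4⟩
  choose! f hf using hch
  refine countable_of_injective_of_countable_image (f := f) (fun c hc c' hc' e => ?_)
    (to_countable _)
  obtain ⟨x, y, hx, hy, k1, k2, k3, k4⟩ := hf c hc
  obtain ⟨x', y', hx', hy', k1', k2', k3', k4'⟩ := hf c' hc'
  rw [← e] at k1' k2' k3' k4'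
  rcases lt_trichotomy c c' with h | h | h
  · exact (h2 _ hx' _ hy (k1'.trans k2) h (k3'.trans k4)).elim
  · exact h
  · exact (h2 _ hx _ hy' (k1.trans k2') h (k3.trans k4')).elim

/-- Connection points are countably many, so at each of them the null one of the two families,
arriving or leaving routes, may be deleted from `T`. -/
theorem isMonotonePlan_of_pairwiseOptimal {π : Measure (ℝ × ℝ)} {T : Set (ℝ × ℝ)}
    (hπ : π Tᶜ = 0) (h1 : PairwiseOptimal T)
    (h2 : NoRightwardCrossing T) (h3 : NoRightwardCrossing (Prod.swap ⁻¹' T))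
    (h4 : ∀ c, π (routesInto c) = 0 ∨ π (routesFrom c) = 0) : IsMonotonePlan π := by
  set C : Set ℝ := {c | ∃ x y, (x, c) ∈ T ∧ (c, y) ∈ T ∧ x ≠ c ∧ y ≠ c} with hC
  have hCc : C.Countable := by
    refine ((countable_rightward_connections h2).union
      (countable_rightward_connections h3)).mono ?_
    rintro c ⟨x, y, hx, hy, hxc, hyc⟩
    -- If the two arches lie on the same side of c, they are opposite and overlap; otherwise both go
    -- right or both go left.
    rcases lt_or_gt_of_ne hxc with h | h <;> rcases lt_or_gt_of_ne hyc with h' | h'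
    · exact (h1.opposite hx hy h h' h' h).elim
    · exact Or.inl ⟨x, y, hx, hy, h, h'⟩
    · exact Or.inr ⟨y, x, hy, hx, h', h⟩
    · exact (h1.opposite hy hx h' h h' h).elim
  set N : Set (ℝ × ℝ) := ⋃ c ∈ C, ((⋃ (_ : π (routesInto c) = 0), routesInto c) ∪
    ⋃ (_ : π (routesFrom c) = 0), routesFrom c) with hN
  have hN0 : π N = 0 := by
    refine (measure_biUnion_null_iff hCc).2 fun c _ => measure_union_null ?_ ?_ <;>
    exact measure_iUnion_null fun h => h
  refine ⟨T \ N, ?_, ?_, ?_, ?_⟩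
  · rw [Set.sdiff_eq, compl_inter, compl_compl]
    exact measure_union_null hπ hN0
  · exact fun x y x' y' h h' =>
      archesDoNotCross_of_pairwiseOptimal h1 h2 h3 x y x' y' h.1 h'.1
  · intro x y x' y' h h' hpos e
    subst e
    rw [lt_min_iff, abs_pos, abs_pos, sub_ne_zero, sub_ne_zero] at hpos
    have hyC : y ∈ C := ⟨x, y', h.1, h'.1, hpos.1.symm, hpos.2⟩
    rcases h4 y with h0 | h0
    · refine h.2 (mem_biUnion hyC (Or.inl ?_))
      exact mem_iUnion.2 ⟨h0, rfl, hpos.1.symm⟩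
    · refine h'.2 (mem_biUnion hyC (Or.inr ?_))
      exact mem_iUnion.2 ⟨h0, rfl, hpos.2⟩
  · exact fun x y x' y' h h' =>
      nestedArchesSameOrientation_of_pairwiseOptimal h1 x y x' y' h.1 h'.1

/-! ### Local improvements of transport plans -/

lemma mem_optMarg.null_of_improving {μ ν : Measure ℝ} [IsProbabilityMeasure μ]
    (hμ : Integrable (fun x : ℝ => |x|) μ) (hν : Integrable (fun x : ℝ => |x|) ν) {p : ℝ}
    (hp : 0 < p) (hp1 : p ≤ 1) {π : Measure (ℝ × ℝ)} (hπ : π ∈ OptMarg p μ ν)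
    {A B : Set (ℝ × ℝ)} (hA : MeasurableSet A) (hB : MeasurableSet B)
    (h : ∀ z ∈ A, ∀ z' ∈ B, |z'.2 - z.1| ^ p + |z.2 - z'.1| ^ p <
      |z.2 - z.1| ^ p + |z'.2 - z'.1| ^ p) : π A = 0 ∨ π B = 0 := by
  by_contra hne
  push Not at hne
  obtain ⟨γ, hγ, hcost⟩ := exists_exchange hπ.1 hA hB
  exact absurd (hπ.2 γ hγ)
    (not_le.2 ((hcost p).2 h hne.1 hne.2 (transportCost_ne_top hμ hν hp hp1 hπ.1)))

/-- The weak inequality for the distance keeps the exchanged plan among the optimal plans for p = 1,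
where it competes for the cost q. -/
lemma IsSecondarySolution.null_of_improving {μ ν : Measure ℝ} [IsProbabilityMeasure μ]
    (hμ : Integrable (fun x : ℝ => |x|) μ) (hν : Integrable (fun x : ℝ => |x|) ν) {q : ℝ}
    (hq : q ∈ Ioo (0 : ℝ) 1) {π : Measure (ℝ × ℝ)} (hπ : IsSecondarySolution q μ ν π)
    {A B : Set (ℝ × ℝ)} (hA : MeasurableSet A) (hB : MeasurableSet B)
    (h1 : ∀ z ∈ A, ∀ z' ∈ B, |z'.2 - z.1| + |z.2 - z'.1| ≤ |z.2 - z.1| + |z'.2 - z'.1|)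
    (h : ∀ z ∈ A, ∀ z' ∈ B, |z'.2 - z.1| ^ q + |z.2 - z'.1| ^ q <
      |z.2 - z.1| ^ q + |z'.2 - z'.1| ^ q) : π A = 0 ∨ π B = 0 := by
  by_contra hne
  push Not at hne
  obtain ⟨γ, hγ, hcost⟩ := exists_exchange hπ.1.1 hA hB
  have hγ1 : γ ∈ OptMarg 1 μ ν :=
    ⟨hγ, fun γ' hγ' => ((hcost 1).1 (by simpa only [Real.rpow_one] using h1)).trans
      (hπ.1.2 γ' hγ')⟩
  exact absurd (hπ.2 γ hγ1)
    (not_le.2 ((hcost q).2 h hne.1 hne.2 (transportCost_ne_top hμ hν hq.1 hq.2.le hπ.1.1)))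

/-- The crossing lengths y - x and y' - x' have the same sum as the nested lengths y - x' and y' - x
and lie strictly between them, so strict concavity applies. The case x' = y is strict subadditivity.
-/
lemma rpow_cross_lt {p : ℝ} (hp : 0 < p) (hp1 : p < 1) {x y x' y' : ℝ} (h1 : x < x')
    (h2 : x' ≤ y) (h3 : y < y') :
    |y' - x| ^ p + |y - x'| ^ p < |y - x| ^ p + |y' - x'| ^ p := by
  rw [abs_of_nonneg (by linarith), abs_of_nonneg (by linarith), abs_of_nonneg (by linarith),
    abs_of_nonneg (by linarith)]
  have hc := Real.strictConcaveOn_rpow hp hp1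
  have ha : y - x' ∈ Ici (0 : ℝ) := by rw [mem_Ici]; linarith
  have hd : y' - x ∈ Ici (0 : ℝ) := by rw [mem_Ici]; linarith
  have hne : y - x' ≠ y' - x := by intro h; linarith
  have hD : 0 < (y' - x) - (y - x') := by linarith
  set D := (y' - x) - (y - x') with hDdef
  -- The two crossing lengths are the convex combinations of the nested ones with these weights,
  -- taken in either order; adding the two concavity inequalities makes the weights disappear.
  have hs : 0 < (x' - x) / D := by apply div_pos <;> linarith
  have ht : 0 < (y' - y) / D := by apply div_pos <;> linarith
  have hst : (y' - y) / D + (x' - x) / D = 1 := by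
    rw [← add_div, div_eq_one_iff_eq hD.ne']; rw [hDdef]; ring
  have e1 : (y' - y) / D * (y - x') + (x' - x) / D * (y' - x) = y - x := by
    field_simp; rw [hDdef]; ring
  have e2 : (x' - x) / D * (y - x') + (y' - y) / D * (y' - x) = y' - x' := by
    field_simp; rw [hDdef]; ring
  have k1 := hc.2 ha hd hne ht hs hst
  have k2 := hc.2 ha hd hne hs ht (by rw [add_comm]; exact hst)
  simp only [smul_eq_mul] at k1 k2
  rw [e1] at k1
  rw [e2] at k2
  have : ((y' - y) / D + (x' - x) / D) * ((y - x') ^ p + (y' - x) ^ p) =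
    (y - x') ^ p + (y' - x) ^ p := by rw [hst, one_mul]
  linarith

lemma rpow_triangle_lt {p : ℝ} (hp : 0 < p) (hp1 : p < 1) {x y c : ℝ} (h1 : x ≠ c)
    (h2 : y ≠ c) : |y - x| ^ p < |c - x| ^ p + |y - c| ^ p := by
  have ha : 0 < |c - x| := abs_pos.2 (sub_ne_zero.2 h1.symm)
  have hb : 0 < |y - c| := abs_pos.2 (sub_ne_zero.2 h2)
  have h := rpow_cross_lt hp hp1 (x := 0) (y := |c - x|) (x' := |c - x|)
    (y' := |c - x| + |y - c|) ha le_rfl (by linarith)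
  rw [sub_zero, sub_zero, sub_self, abs_zero, Real.zero_rpow hp.ne', add_zero, add_sub_cancel_left,
    abs_of_nonneg (by linarith : 0 ≤ |c - x| + |y - c|), abs_abs, abs_abs] at h
  have hle : |y - x| ≤ |c - x| + |y - c| := by
    have := abs_add_le (c - x) (y - c)
    rwa [show c - x + (y - c) = y - x by ring] at this
  calc |y - x| ^ p ≤ (|c - x| + |y - c|) ^ p :=
        Real.rpow_le_rpow (abs_nonneg _) hle hp.le
    _ < _ := h

/-- A neighbourhood of a point in the support of the limit is eventually charged, by the portmanteau
theorem. An open condition on two routes of the limit is thus realized by routes of the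
approximating plans. -/
lemma exists_open_of_mem_support {πs : ℕ → ProbabilityMeasure (ℝ × ℝ)}
    {π : ProbabilityMeasure (ℝ × ℝ)} (hlim : Tendsto πs atTop (𝓝 π)) {z z' : ℝ × ℝ}
    (hz : z ∈ (π : Measure (ℝ × ℝ)).support) (hz' : z' ∈ (π : Measure (ℝ × ℝ)).support)
    {Q : (ℝ × ℝ) × (ℝ × ℝ) → Prop} (hQ : ∀ᶠ w in 𝓝 (z, z'), Q w) :
    ∃ A B : Set (ℝ × ℝ), IsOpen A ∧ IsOpen B ∧ (∀ w ∈ A, ∀ w' ∈ B, Q (w, w')) ∧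
      ∀ᶠ n in atTop, (πs n : Measure (ℝ × ℝ)) A ≠ 0 ∧ (πs n : Measure (ℝ × ℝ)) B ≠ 0 := by
  rw [nhds_prod_eq] at hQ
  obtain ⟨U, hU, V, hV, hUV⟩ := eventually_prod_iff.1 hQ
  obtain ⟨A, hAU, hAo, hzA⟩ := mem_nhds_iff.1 hU
  obtain ⟨B, hBV, hBo, hzB⟩ := mem_nhds_iff.1 hV
  have key : ∀ {O : Set (ℝ × ℝ)} {w : ℝ × ℝ}, IsOpen O → w ∈ O →
      w ∈ (π : Measure (ℝ × ℝ)).support → ∀ᶠ n in atTop, (πs n : Measure (ℝ × ℝ)) O ≠ 0 := by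
    intro O w hO hw hws
    have h0 : 0 < (π : Measure (ℝ × ℝ)) O :=
      (Measure.mem_support_iff_forall w).1 hws O (hO.mem_nhds hw)
    exact (eventually_lt_of_lt_liminf (h0.trans_le
      (ProbabilityMeasure.le_liminf_measure_open_of_tendsto hlim hO))).mono fun n hn => hn.ne'
  exact ⟨A, B, hAo, hBo, fun w hw w' hw' => hUV (hAU hw) (hBV hw'),
    (key hAo hzA hz).and (key hBo hzB hz')⟩

/-- Weak limits of optimal plans are pairwise optimal on their support. -/
lemma pairwiseOptimal_support_of_tendsto {μ ν : Measure ℝ} [IsProbabilityMeasure μ]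
    (hμ : Integrable (fun x : ℝ => |x|) μ) (hν : Integrable (fun x : ℝ => |x|) ν)
    {πs : ℕ → ProbabilityMeasure (ℝ × ℝ)} {p : ℕ → ℝ} (hp : ∀ n, 0 < p n ∧ p n ≤ 1)
    (hopt : ∀ n, (πs n : Measure (ℝ × ℝ)) ∈ OptMarg (p n) μ ν)
    {π : ProbabilityMeasure (ℝ × ℝ)} (hlim : Tendsto πs atTop (𝓝 π))
    (hplim : Tendsto p atTop (𝓝 1)) : PairwiseOptimal (π : Measure (ℝ × ℝ)).support := by
  intro z hz z' hz'
  by_contra hneg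
  push Not at hneg
  -- The gain of the exchange as a function of the exponent and the two routes; it is jointly
  -- continuous at exponent 1, even where a length is zero, because the exponent is positive there.
  set D : ℝ × (ℝ × ℝ) × (ℝ × ℝ) → ℝ := fun w =>
    |w.2.1.2 - w.2.1.1| ^ w.1 + |w.2.2.2 - w.2.2.1| ^ w.1 -
      (|w.2.2.2 - w.2.1.1| ^ w.1 + |w.2.1.2 - w.2.2.1| ^ w.1) with hD
  have hcont : ContinuousAt D (1, z, z') := by
    have hr : ∀ f : ℝ × (ℝ × ℝ) × (ℝ × ℝ) → ℝ, Continuous f →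
        ContinuousAt (fun w => f w ^ w.1) (1, z, z') := fun f hf =>
      ContinuousAt.rpow hf.continuousAt continuousAt_fst (Or.inr one_pos)
    exact ((hr _ (by fun_prop)).add (hr _ (by fun_prop))).sub
      ((hr _ (by fun_prop)).add (hr _ (by fun_prop)))
  have hpos : 0 < D (1, z, z') := by
    simp only [hD, Real.rpow_one]; linarith
  have hev := hcont.eventually (lt_mem_nhds hpos)
  rw [nhds_prod_eq] at hev
  obtain ⟨P, hP, Q, hQ, hPQ⟩ := eventually_prod_iff.1 hev
  obtain ⟨A, B, hAo, hBo, hAB, hne⟩ := exists_open_of_mem_support hlim hz hz' hQ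
  obtain ⟨n, hn, hnA, hnB⟩ := ((hplim.eventually hP).and hne).exists
  rcases mem_optMarg.null_of_improving hμ hν (hp n).1 (hp n).2 (hopt n) hAo.measurableSet
    hBo.measurableSet (fun w hw w' hw' => by
      have := hPQ hn (hAB w hw w' hw')
      simp only [hD] at this
      linarith) with h | h
  · exact hnA h
  · exact hnB h

/-! ### Strict crossings are open conditions; secondary solutions are monotone -/

lemma eventually_rightward_crossing {z z' : ℝ × ℝ} (h1 : z.1 < z'.1) (h2 : z'.1 < z.2)
    (h3 : z.2 < z'.2) :
    ∀ᶠ w in 𝓝 (z, z'), w.1.1 < w.2.1 ∧ w.2.1 < w.1.2 ∧ w.1.2 < w.2.2 := by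
  have e : ∀ f g : (ℝ × ℝ) × (ℝ × ℝ) → ℝ, Continuous f → Continuous g → f (z, z') < g (z, z') →
      ∀ᶠ w in 𝓝 (z, z'), f w < g w := fun f g hf hg h =>
    hf.continuousAt.eventually_lt hg.continuousAt h
  exact (e _ _ (by fun_prop) (by fun_prop) h1).and
    ((e _ _ (by fun_prop) (by fun_prop) h2).and (e _ _ (by fun_prop) (by fun_prop) h3))

lemma eventually_leftward_crossing {z z' : ℝ × ℝ} (h1 : z.2 < z'.2) (h2 : z'.2 < z.1)
    (h3 : z.1 < z'.1) :
    ∀ᶠ w in 𝓝 (z, z'), w.1.2 < w.2.2 ∧ w.2.2 < w.1.1 ∧ w.1.1 < w.2.1 := by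
  have e : ∀ f g : (ℝ × ℝ) × (ℝ × ℝ) → ℝ, Continuous f → Continuous g → f (z, z') < g (z, z') →
      ∀ᶠ w in 𝓝 (z, z'), f w < g w := fun f g hf hg h =>
    hf.continuousAt.eventually_lt hg.continuousAt h
  exact (e _ _ (by fun_prop) (by fun_prop) h1).and
    ((e _ _ (by fun_prop) (by fun_prop) h2).and (e _ _ (by fun_prop) (by fun_prop) h3))

lemma rpow_leftward_cross_lt {p : ℝ} (hp : 0 < p) (hp1 : p < 1) {x y x' y' : ℝ} (h1 : y < y')
    (h2 : y' ≤ x) (h3 : x < x') :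
    |y' - x| ^ p + |y - x'| ^ p < |y - x| ^ p + |y' - x'| ^ p := by
  have := rpow_cross_lt hp hp1 h1 h2 h3
  rw [abs_sub_comm y' x, abs_sub_comm y x', abs_sub_comm y x, abs_sub_comm y' x']
  linarith

theorem IsSecondarySolution.isMonotonePlan {μ ν : Measure ℝ} [IsProbabilityMeasure μ]
    (hμ : Integrable (fun x : ℝ => |x|) μ) (hν : Integrable (fun x : ℝ => |x|) ν) {q : ℝ}
    (hq : q ∈ Ioo (0 : ℝ) 1) {π : Measure (ℝ × ℝ)} (hπ : IsSecondarySolution q μ ν π) :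
    IsMonotonePlan π := by
  have := isProbabilityMeasure_of_mem_marg hπ.1.1
  obtain ⟨P, rfl⟩ : ∃ P : ProbabilityMeasure (ℝ × ℝ), (P : Measure (ℝ × ℝ)) = π := ⟨⟨π, this⟩, rfl⟩
  -- A constant sequence turns the results on weak limits into results on the support of `P`.
  have hconst : Tendsto (fun _ : ℕ => P) atTop (𝓝 P) := tendsto_const_nhds
  refine isMonotonePlan_of_pairwiseOptimal Measure.measure_compl_support
    (pairwiseOptimal_support_of_tendsto hμ hν (p := fun _ => 1) (fun _ => ⟨one_pos, le_rfl⟩)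
      (fun _ => hπ.1) hconst tendsto_const_nhds) ?_ ?_ ?_
  · intro z hz z' hz' h1 h2 h3
    obtain ⟨A, B, hAo, hBo, hAB, hne⟩ := exists_open_of_mem_support hconst hz hz'
      (eventually_rightward_crossing h1 h2 h3)
    obtain ⟨n, hnA, hnB⟩ := hne.exists
    refine (hπ.null_of_improving hμ hν hq hAo.measurableSet hBo.measurableSet
      (fun w hw w' hw' => ?_) (fun w hw w' hw' => ?_)).elim hnA hnB
    · obtain ⟨k1, k2, k3⟩ := hAB w hw w' hw'
      simp only at k1 k2 k3
      rw [abs_of_nonneg (by linarith), abs_of_nonneg (by linarith), abs_of_nonneg (by linarith),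
        abs_of_nonneg (by linarith)]
      linarith
    · obtain ⟨k1, k2, k3⟩ := hAB w hw w' hw'
      exact rpow_cross_lt hq.1 hq.2 k1 k2.le k3
  · intro z hz z' hz' h1 h2 h3
    obtain ⟨A, B, hAo, hBo, hAB, hne⟩ := exists_open_of_mem_support hconst hz hz'
      (eventually_leftward_crossing h1 h2 h3)
    obtain ⟨n, hnA, hnB⟩ := hne.exists
    refine (hπ.null_of_improving hμ hν hq hAo.measurableSet hBo.measurableSet
      (fun w hw w' hw' => ?_) (fun w hw w' hw' => ?_)).elim hnA hnB
    · obtain ⟨k1, k2, k3⟩ := hAB w hw w' hw'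
      simp only at k1 k2 k3
      rw [abs_of_nonpos (by linarith), abs_of_nonpos (by linarith), abs_of_nonpos (by linarith),
        abs_of_nonpos (by linarith)]
      linarith
    · obtain ⟨k1, k2, k3⟩ := hAB w hw w' hw'
      exact rpow_leftward_cross_lt hq.1 hq.2 k1 k2.le k3
  -- For p = 1 the exchange at a connection may only tie after a perturbation of the routes, so no
  -- neighbourhoods are used: the exchange is applied to all routes into c and all routes from c.
  · intro c
    refine hπ.null_of_improving hμ hν hq (measurableSet_routesInto c) (measurableSet_routesFrom c)
      ?_ ?_
    · rintro ⟨x, y⟩ ⟨h1, h2⟩ ⟨x', y'⟩ ⟨h3, h4⟩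
      simp only at h1 h2 h3 h4
      subst h1 h3
      rw [sub_self, abs_zero, add_zero, add_comm]
      exact abs_sub_le _ _ _
    · rintro ⟨x, y⟩ ⟨h1, h2⟩ ⟨x', y'⟩ ⟨h3, h4⟩
      simp only at h1 h2 h3 h4
      subst h1 h3
      rw [sub_self, abs_zero, Real.zero_rpow hq.1.ne', add_zero]
      exact rpow_triangle_lt hq.1 hq.2 h2 h4

/-- For a strictly concave cost, the arches of the support of an optimal plan do not connect. -/
lemma archesDoNotConnect_support {μ ν : Measure ℝ} [IsProbabilityMeasure μ]
    (hμ : Integrable (fun x : ℝ => |x|) μ) (hν : Integrable (fun x : ℝ => |x|) ν) {p : ℝ}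
    (hp : 0 < p) (hp1 : p < 1) {π : Measure (ℝ × ℝ)} (hπ : π ∈ OptMarg p μ ν) :
    ArchesDoNotConnect π.support := by
  have := isProbabilityMeasure_of_mem_marg hπ.1
  obtain ⟨P, rfl⟩ : ∃ P : ProbabilityMeasure (ℝ × ℝ), (P : Measure (ℝ × ℝ)) = π := ⟨⟨π, this⟩, rfl⟩
  have hconst : Tendsto (fun _ : ℕ => P) atTop (𝓝 P) := tendsto_const_nhds
  rintro x y x' y' hz hz' hpos rfl
  rw [lt_min_iff, abs_pos, abs_pos, sub_ne_zero, sub_ne_zero] at hpos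
  have hr : ∀ f : (ℝ × ℝ) × (ℝ × ℝ) → ℝ, Continuous f → Continuous (fun w => f w ^ p) :=
    fun f hf => hf.rpow_const fun _ => Or.inr hp.le
  -- For a fixed p < 1 the gain at a connection is strict, hence persists nearby. It degenerates as
  -- p tends to 1, so this does not pass to limit solutions.
  have hev : ∀ᶠ w in 𝓝 ((x, y), (y, y')), |w.2.2 - w.1.1| ^ p + |w.1.2 - w.2.1| ^ p <
      |w.1.2 - w.1.1| ^ p + |w.2.2 - w.2.1| ^ p := by
    refine ContinuousAt.eventually_lt
      ((hr _ (by fun_prop)).add (hr _ (by fun_prop))).continuousAt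
      ((hr _ (by fun_prop)).add (hr _ (by fun_prop))).continuousAt ?_
    simp only [sub_self, abs_zero, Real.zero_rpow hp.ne', add_zero]
    exact rpow_triangle_lt hp hp1 hpos.1.symm hpos.2
  obtain ⟨A, B, hAo, hBo, hAB, hne⟩ := exists_open_of_mem_support hconst hz hz' hev
  obtain ⟨n, hnA, hnB⟩ := hne.exists
  exact (mem_optMarg.null_of_improving hμ hν hp hp1.le hπ hAo.measurableSet hBo.measurableSet
    hAB).elim hnA hnB

/-! ### The common part of two measures -/

lemma measure_add_left_cancel {α : Type*} [MeasurableSpace α] {η a b : Measure α}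
    [IsFiniteMeasure η] (h : η + a = η + b) : a = b := by
  ext s hs
  have := congrArg (fun m : Measure α => m s) h
  simp only [Measure.add_apply] at this
  exact (ENNReal.add_right_inj (measure_ne_top η s)).1 this

/-- The pair of singular parts is the Jordan decomposition of the signed measure μ - ν, in which η
cancels. -/
lemma singular_decomposition_unique {η μ₀ ν₀ η' μ₀' ν₀' : Measure ℝ} [IsFiniteMeasure η]
    [IsFiniteMeasure μ₀] [IsFiniteMeasure ν₀] [IsFiniteMeasure η'] [IsFiniteMeasure μ₀']
    [IsFiniteMeasure ν₀'] (h1 : η + μ₀ = η' + μ₀') (h2 : η + ν₀ = η' + ν₀')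
    (h : μ₀ ⟂ₘ ν₀) (h' : μ₀' ⟂ₘ ν₀') : η = η' ∧ μ₀ = μ₀' ∧ ν₀ = ν₀' := by
  have e : (⟨μ₀, ν₀, h⟩ : JordanDecomposition ℝ) = ⟨μ₀', ν₀', h'⟩ := by
    apply JordanDecomposition.toSignedMeasure_injective
    ext s hs
    have k1 : (η + μ₀).real s = (η' + μ₀').real s := by rw [h1]
    have k2 : (η + ν₀).real s = (η' + ν₀').real s := by rw [h2]
    rw [measureReal_add_apply, measureReal_add_apply] at k1 k2
    simp only [JordanDecomposition.toSignedMeasure, sub_apply,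
      Measure.toSignedMeasure_apply_measurable hs]
    linarith
  rw [JordanDecomposition.mk.injEq] at e
  obtain ⟨rfl, rfl⟩ := e
  refine ⟨?_, rfl, rfl⟩
  rw [add_comm η, add_comm η'] at h1
  exact measure_add_left_cancel h1

/-- The routes of positive length. -/
def movingRoutes : Set (ℝ × ℝ) := {z | z.1 ≠ z.2}

lemma measurableSet_movingRoutes : MeasurableSet movingRoutes :=
  (measurableSet_eq_fun measurable_fst measurable_snd).compl

lemma measurable_diagMap : Measurable (fun x : ℝ => (x, x)) := by fun_prop

lemma map_diag_eq_restrict (π : Measure (ℝ × ℝ)) :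
    ((π.restrict movingRoutesᶜ).map Prod.fst).map (fun x => (x, x)) = π.restrict movingRoutesᶜ := by
  rw [Measure.map_map measurable_diagMap measurable_fst]
  conv_rhs => rw [← Measure.map_id (μ := π.restrict movingRoutesᶜ)]
  refine Measure.map_congr ?_
  filter_upwards [ae_restrict_mem measurableSet_movingRoutes.compl] with z hz
  have : z.1 = z.2 := not_not.1 hz
  ext <;> simp [this]

lemma restrict_diag_map_snd (π : Measure (ℝ × ℝ)) :
    (π.restrict movingRoutesᶜ).map Prod.snd = (π.restrict movingRoutesᶜ).map Prod.fst := by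
  refine Measure.map_congr ?_
  filter_upwards [ae_restrict_mem measurableSet_movingRoutes.compl] with z hz
  exact (not_not.1 hz).symm

/-- A plan whose arches do not connect moves mass between mutually singular measures. -/
lemma mutuallySingular_of_archesDoNotConnect {π : Measure (ℝ × ℝ)} {S : Set (ℝ × ℝ)}
    (hS : π Sᶜ = 0) (hc : ArchesDoNotConnect S) :
    (π.restrict movingRoutes).map Prod.fst ⟂ₘ (π.restrict movingRoutes).map Prod.snd := by
  set T := (toMeasurable π Sᶜ)ᶜ ∩ movingRoutes
  have hTm : MeasurableSet T := (measurableSet_toMeasurable _ _).compl.inter measurableSet_movingRoutes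
  have hTS : (toMeasurable π Sᶜ)ᶜ ⊆ S := compl_subset_comm.1 (subset_toMeasurable π Sᶜ)
  have hdisj : Disjoint (Prod.fst '' T) (Prod.snd '' T) := by
    rw [Set.disjoint_left]
    rintro _ ⟨⟨x, y⟩, hz, rfl⟩ ⟨⟨x', y'⟩, hz', e⟩
    simp only at e
    refine hc x' y' x y (hTS hz'.1) (hTS hz.1) ?_ e
    rw [lt_min_iff, abs_pos, abs_pos, sub_ne_zero, sub_ne_zero]
    exact ⟨Ne.symm hz'.2, Ne.symm hz.2⟩
  -- The sets of targets and of sources are disjoint but only analytic, as projections of a Borel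
  -- set; Lusin's theorem separates them by a Borel set.
  obtain ⟨u, hu1, hu2, hu⟩ := AnalyticSet.measurablySeparable
    (hTm.analyticSet.image_of_continuous continuous_snd)
    (hTm.analyticSet.image_of_continuous continuous_fst) hdisj.symm
  have hnull : ∀ w : Set (ℝ × ℝ), w ∩ T = ∅ → π (w ∩ movingRoutes) = 0 := by
    intro w hw
    refine measure_mono_null ?_ ((measure_toMeasurable Sᶜ).trans hS)
    intro z hz
    by_contra hzn
    exact (hw.subset ⟨hz.1, hzn, hz.2⟩ : z ∈ (∅ : Set (ℝ × ℝ)))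
  refine ⟨u, hu, ?_, ?_⟩
  · rw [Measure.map_apply measurable_fst hu, Measure.restrict_apply (measurable_fst hu)]
    refine hnull _ ?_
    rw [eq_empty_iff_forall_notMem]
    exact fun z hz => Set.disjoint_left.1 hu2 (mem_image_of_mem _ hz.2) hz.1
  · rw [Measure.map_apply measurable_snd hu.compl,
      Measure.restrict_apply (measurable_snd hu.compl)]
    refine hnull _ ?_
    rw [eq_empty_iff_forall_notMem]
    exact fun z hz => hz.1 (hu1 (mem_image_of_mem _ hz.2))

lemma marg_decomposition {μ ν : Measure ℝ} {π : Measure (ℝ × ℝ)} (hπ : π ∈ Marg μ ν) :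
    μ = (π.restrict movingRoutesᶜ).map Prod.fst + (π.restrict movingRoutes).map Prod.fst ∧
    ν = (π.restrict movingRoutesᶜ).map Prod.fst + (π.restrict movingRoutes).map Prod.snd := by
  have e : π.restrict movingRoutesᶜ + π.restrict movingRoutes = π :=
    Measure.restrict_compl_add_restrict measurableSet_movingRoutes
  constructor
  · rw [← Measure.map_add _ _ measurable_fst, e, hπ.1]
  · rw [← restrict_diag_map_snd, ← Measure.map_add _ _ measurable_snd, e, hπ.2]

/-- Crossings and opposite overlaps are inherited from the approximating plans. Connections are
excluded through the marginals: the part of the limit beyond the fixed common mass has mutually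
singular marginals. -/
theorem IsLimitSolution.isMonotonePlan {μ ν : Measure ℝ} [IsProbabilityMeasure μ]
    [IsProbabilityMeasure ν]
    (hμ : Integrable (fun x : ℝ => |x|) μ) (hν : Integrable (fun x : ℝ => |x|) ν)
    {π : ProbabilityMeasure (ℝ × ℝ)} (hmarg : (π : Measure (ℝ × ℝ)) ∈ Marg μ ν)
    (hπ : IsLimitSolution μ ν π) : IsMonotonePlan (π : Measure (ℝ × ℝ)) := by
  obtain ⟨πs, p, hp, hopt, hlim⟩ := hπ
  have hplim : Tendsto p atTop (𝓝 1) := (continuous_snd.tendsto _).comp hlim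
  have hlim : Tendsto πs atTop (𝓝 π) := (continuous_fst.tendsto _).comp hlim
  have hsing : ∀ n, ((πs n : Measure (ℝ × ℝ)).restrict movingRoutes).map Prod.fst ⟂ₘ
      ((πs n : Measure (ℝ × ℝ)).restrict movingRoutes).map Prod.snd := fun n =>
    mutuallySingular_of_archesDoNotConnect Measure.measure_compl_support
      (archesDoNotConnect_support hμ hν (hp n).1 (hp n).2 (hopt n))
  set η := ((πs 0 : Measure (ℝ × ℝ)).restrict movingRoutesᶜ).map Prod.fst
  set μ₀ := ((πs 0 : Measure (ℝ × ℝ)).restrict movingRoutes).map Prod.fst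
  set ν₀ := ((πs 0 : Measure (ℝ × ℝ)).restrict movingRoutes).map Prod.snd
  obtain ⟨hμη, hνη⟩ : μ = η + μ₀ ∧ ν = η + ν₀ := marg_decomposition (hopt 0).1
  -- For each n the moving marginals are mutually singular, so the fixed mass does not depend on n.
  have hηn : ∀ n, ((πs n : Measure (ℝ × ℝ)).restrict movingRoutesᶜ).map Prod.fst = η := fun n =>
    (singular_decomposition_unique ((marg_decomposition (hopt n).1).1.symm.trans hμη)
      ((marg_decomposition (hopt n).1).2.symm.trans hνη) (hsing n) (hsing 0)).1
  have hle_n : ∀ n, η.map (fun x => (x, x)) ≤ (πs n : Measure (ℝ × ℝ)) := by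
    intro n
    rw [← hηn n, map_diag_eq_restrict]
    exact Measure.restrict_le_self
  -- Domination passes to the weak limit on closed sets, then to Borel sets by inner regularity.
  have hle : η.map (fun x => (x, x)) ≤ (π : Measure (ℝ × ℝ)) := by
    refine Measure.le_iff.2 fun s hs => ?_
    rw [hs.measure_eq_iSup_isClosed_of_ne_top (measure_ne_top _ _)]
    refine iSup₂_le fun K hK => iSup_le fun hKc => ?_
    refine le_trans ?_ (measure_mono hK)
    refine le_trans ?_ (ProbabilityMeasure.limsup_measure_closed_le_of_tendsto hlim hKc)
    exact le_limsup_of_frequently_le' (Frequently.of_forall fun n => hle_n n K)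
  set π₀ := (π : Measure (ℝ × ℝ)) - η.map (fun x => (x, x))
  have hsum : π₀ + η.map (fun x => (x, x)) = (π : Measure (ℝ × ℝ)) :=
    Measure.sub_add_cancel_of_le hle
  have hπ₀1 : π₀.map Prod.fst = μ₀ := by
    have h := hmarg.1
    rw [← hsum, Measure.map_add _ _ measurable_fst, Measure.map_map measurable_fst measurable_diagMap,
      hμη, add_comm, show Prod.fst ∘ (fun x : ℝ => (x, x)) = id from rfl, Measure.map_id] at h
    exact measure_add_left_cancel h
  have hπ₀2 : π₀.map Prod.snd = ν₀ := by
    have h := hmarg.2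
    rw [← hsum, Measure.map_add _ _ measurable_snd, Measure.map_map measurable_snd measurable_diagMap,
      hνη, add_comm, show Prod.snd ∘ (fun x : ℝ => (x, x)) = id from rfl, Measure.map_id] at h
    exact measure_add_left_cancel h
  refine isMonotonePlan_of_pairwiseOptimal Measure.measure_compl_support
    (pairwiseOptimal_support_of_tendsto hμ hν (fun n => ⟨(hp n).1, (hp n).2.le⟩) hopt hlim hplim)
    ?_ ?_ ?_
  · intro z hz z' hz' h1 h2 h3
    obtain ⟨A, B, hAo, hBo, hAB, hne⟩ := exists_open_of_mem_support hlim hz hz'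
      (eventually_rightward_crossing h1 h2 h3)
    obtain ⟨n, hnA, hnB⟩ := hne.exists
    refine (mem_optMarg.null_of_improving hμ hν (hp n).1 (hp n).2.le (hopt n) hAo.measurableSet
      hBo.measurableSet fun w hw w' hw' => ?_).elim hnA hnB
    obtain ⟨k1, k2, k3⟩ := hAB w hw w' hw'
    exact rpow_cross_lt (hp n).1 (hp n).2 k1 k2.le k3
  · intro z hz z' hz' h1 h2 h3
    obtain ⟨A, B, hAo, hBo, hAB, hne⟩ := exists_open_of_mem_support hlim hz hz'
      (eventually_leftward_crossing h1 h2 h3)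
    obtain ⟨n, hnA, hnB⟩ := hne.exists
    refine (mem_optMarg.null_of_improving hμ hν (hp n).1 (hp n).2.le (hopt n) hAo.measurableSet
      hBo.measurableSet fun w hw w' hw' => ?_).elim hnA hnB
    obtain ⟨k1, k2, k3⟩ := hAB w hw w' hw'
    exact rpow_leftward_cross_lt (hp n).1 (hp n).2 k1 k2.le k3
  · intro c
    by_contra hne
    push Not at hne
    -- Off the diagonal π is `π₀`, so charged routes both into and from c would make c an atom of
    -- both `ν₀` and `μ₀`.
    have hoff : ∀ A : Set (ℝ × ℝ), MeasurableSet A → A ⊆ movingRoutes →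
        (π : Measure (ℝ × ℝ)) A = π₀ A := by
      intro A hA hAo
      rw [← hsum, Measure.add_apply, Measure.map_apply measurable_diagMap hA,
        show (fun x : ℝ => (x, x)) ⁻¹' A = ∅ from ?_, measure_empty, add_zero]
      rw [eq_empty_iff_forall_notMem]
      exact fun x hx => hAo hx rfl
    rw [hoff _ (measurableSet_routesInto c) fun z hz => by rw [← hz.1] at hz; exact hz.2,
      hoff _ (measurableSet_routesFrom c) fun z hz => by
        rw [← hz.1] at hz; exact Ne.symm hz.2] at hne
    have hν₀ : ν₀ {c} ≠ 0 := by
      rw [← hπ₀2, Measure.map_apply measurable_snd (measurableSet_singleton c)]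
      exact fun h0 => hne.1 (measure_mono_null (fun z hz => hz.1) h0)
    have hμ₀ : μ₀ {c} ≠ 0 := by
      rw [← hπ₀1, Measure.map_apply measurable_fst (measurableSet_singleton c)]
      exact fun h0 => hne.2 (measure_mono_null (fun z hz => hz.1) h0)
    obtain ⟨s, -, hs1, hs2⟩ := hsing 0
    by_cases hcs : c ∈ s
    · exact hμ₀ (measure_mono_null (singleton_subset_iff.2 hcs) hs1)
    · exact hν₀ (measure_mono_null (singleton_subset_iff.2 hcs) hs2)

/-! ### The mass of the arches over a segment -/

/-- No rightward route of `S` passes over a point that a leftward route of `S` passes over. -/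
def NoOppositeOverlap (S : Set (ℝ × ℝ)) : Prop :=
  ∀ z ∈ S, ∀ z' ∈ S, ∀ t, z.1 ≤ t → t < z.2 → z'.2 ≤ t → t < z'.1 → False

/-- The rightward routes of `S` neither cross nor connect. -/
def RightwardLaminar (S : Set (ℝ × ℝ)) : Prop :=
  ∀ z ∈ S, ∀ z' ∈ S, z.1 < z'.1 → z'.1 ≤ z.2 → z.2 < z'.2 → False

lemma ArchesDoNotCross.subset_or_subset {S : Set (ℝ × ℝ)} (h1 : ArchesDoNotCross S)
    {x y x' y' s t : ℝ} (h : (x, y) ∈ S) (h' : (x', y') ∈ S) (hs : s ∈ uIcc x y)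
    (hs' : s ∈ uIcc x' y') (ht : t ∈ uIcc x y) (ht' : t ∈ uIcc x' y') (hne : s ≠ t) :
    uIcc x y ⊆ uIcc x' y' ∨ uIcc x' y' ⊆ uIcc x y := by
  rcases h1 x y x' y' h h' with h0 | ⟨w, hw⟩ | h0
  · exact (h0.subset ⟨hs, hs'⟩ : s ∈ (∅ : Set ℝ)).elim
  · have e1 : s = w := hw.subset ⟨hs, hs'⟩
    have e2 : t = w := hw.subset ⟨ht, ht'⟩
    exact (hne (e1.trans e2.symm)).elim
  · exact h0

/-- Overlapping arches are nested since they do not cross. For opposite arches, the absence of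
connections makes the nesting strict at both ends, and the orientation condition is violated. -/
lemma noOppositeOverlap_of_arches {S : Set (ℝ × ℝ)} (h1 : ArchesDoNotCross S)
    (h2 : ArchesDoNotConnect S) (h3 : NestedArchesSameOrientation S) : NoOppositeOverlap S := by
  rintro ⟨x, y⟩ h ⟨x', y'⟩ h' t k1 k2 k3 k4
  simp only at k1 k2 k3 k4
  have hxy : x < y := k1.trans_lt k2
  have hxy' : y' < x' := k3.trans_lt k4
  have hpos : 0 < min |y - x| |y' - x'| :=
    lt_min (abs_pos.2 (sub_ne_zero.2 hxy.ne')) (abs_pos.2 (sub_ne_zero.2 hxy'.ne))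
  have n1 : y ≠ x' := h2 x y x' y' h h' hpos
  have n2 : y' ≠ x := h2 x' y' x y h' h (by rwa [min_comm])
  -- The half-open conditions on t make this second common point different from t.
  have hsub := h1.subset_or_subset h h' (s := t) (t := min y x')
    (by rw [uIcc_of_le hxy.le]; exact ⟨k1, k2.le⟩)
    (by rw [uIcc_of_ge hxy'.le]; exact ⟨k3, k4.le⟩)
    (by rw [uIcc_of_le hxy.le]; exact ⟨k1.trans (lt_min k2 k4).le, min_le_left _ _⟩)
    (by rw [uIcc_of_ge hxy'.le]; exact ⟨k3.trans (lt_min k2 k4).le, min_le_right _ _⟩)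
    (lt_min k2 k4).ne
  rw [uIcc_of_le hxy.le, uIcc_of_ge hxy'.le, Icc_subset_Icc_iff hxy.le,
    Icc_subset_Icc_iff hxy'.le] at hsub
  rcases hsub with ⟨c1, c2⟩ | ⟨c1, c2⟩
  · have := h3 x' y' x y h' h (by
      rw [uIcc_of_le hxy.le, uIoo_of_gt hxy']
      exact fun w hw => ⟨(lt_of_le_of_ne c1 n2).trans_le hw.1,
        hw.2.trans_lt (lt_of_le_of_ne c2 n1)⟩)
    nlinarith [mul_pos (sub_pos.2 hxy') (sub_pos.2 hxy)]
  · have := h3 x y x' y' h h' (by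
      rw [uIcc_of_ge hxy'.le, uIoo_of_lt hxy]
      exact fun w hw => ⟨(lt_of_le_of_ne c1 n2.symm).trans_le hw.1,
        hw.2.trans_lt (lt_of_le_of_ne c2 n1.symm)⟩)
    nlinarith [mul_pos (sub_pos.2 hxy') (sub_pos.2 hxy)]

lemma rightwardLaminar_of_arches {S : Set (ℝ × ℝ)} (h1 : ArchesDoNotCross S)
    (h2 : ArchesDoNotConnect S) : RightwardLaminar S := by
  rintro ⟨x, y⟩ h ⟨x', y'⟩ h' k1 k2 k3
  simp only at k1 k2 k3
  have hxy : x < y := k1.trans_le k2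
  have hxy' : x' < y' := k2.trans_lt k3
  have hpos : 0 < min |y - x| |y' - x'| :=
    lt_min (abs_pos.2 (sub_ne_zero.2 hxy.ne')) (abs_pos.2 (sub_ne_zero.2 hxy'.ne'))
  have n1 : y ≠ x' := h2 x y x' y' h h' hpos
  have hsub := h1.subset_or_subset h h' (s := x') (t := y)
    (by rw [uIcc_of_le hxy.le]; exact ⟨k1.le, k2⟩)
    left_mem_uIcc right_mem_uIcc
    (by rw [uIcc_of_le hxy'.le]; exact ⟨k2, k3.le⟩) n1.symm
  rw [uIcc_of_le hxy.le, uIcc_of_le hxy'.le, Icc_subset_Icc_iff hxy.le,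
    Icc_subset_Icc_iff hxy'.le] at hsub
  rcases hsub with ⟨c1, c2⟩ | ⟨c1, c2⟩ <;> linarith

lemma rightwardLaminar_swap_of_arches {S : Set (ℝ × ℝ)} (h1 : ArchesDoNotCross S)
    (h2 : ArchesDoNotConnect S) : RightwardLaminar (Prod.swap ⁻¹' S) := by
  refine rightwardLaminar_of_arches ?_ ?_
  · intro x y x' y' h h'
    rw [uIcc_comm x y, uIcc_comm x' y']
    exact h1 y x y' x' h h'
  · intro x y x' y' h h' hpos e
    refine h2 y' x' y x h' h ?_ e.symm
    rwa [abs_sub_comm x' y', abs_sub_comm x y, min_comm]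

lemma NoOppositeOverlap.swap {S : Set (ℝ × ℝ)} (h : NoOppositeOverlap S) :
    NoOppositeOverlap (Prod.swap ⁻¹' S) :=
  fun z hz z' hz' t k1 k2 k3 k4 => h z'.swap hz' z.swap hz t k3 k4 k1 k2

/-- F is the net flux past t: the mass that stays on the left of t counts in both distribution
functions and cancels. -/
lemma diffCDF_eq_of_mem_marg {μ ν : Measure ℝ} {π : Measure (ℝ × ℝ)} [IsFiniteMeasure π]
    (hπ : π ∈ Marg μ ν) (t : ℝ) :
    diffCDF μ ν t = π.real (Iic t ×ˢ Ioi t) - π.real (Ioi t ×ˢ Iic t) := by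
  have e1 : μ.real (Iic t) = π.real (Iic t ×ˢ Ioi t) + π.real (Iic t ×ˢ Iic t) := by
    rw [← hπ.1, map_measureReal_apply measurable_fst measurableSet_Iic,
      ← measureReal_union (by
        rw [Set.disjoint_prod]; right; exact (Iic_disjoint_Ioi le_rfl).symm)
        (measurableSet_Iic.prod measurableSet_Iic), ← prod_union, union_comm, Iic_union_Ioi,
      prod_univ]
  have e2 : ν.real (Iic t) = π.real (Ioi t ×ˢ Iic t) + π.real (Iic t ×ˢ Iic t) := by
    rw [← hπ.2, map_measureReal_apply measurable_snd measurableSet_Iic,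
      ← measureReal_union (by
        rw [Set.disjoint_prod]; left; exact (Iic_disjoint_Ioi le_rfl).symm)
        (measurableSet_Iic.prod measurableSet_Iic), ← union_prod, union_comm, Iic_union_Ioi,
      univ_prod]
  rw [diffCDF, e1, e2]
  ring

lemma neg_one_le_diffCDF (μ ν : Measure ℝ) [IsProbabilityMeasure ν] (t : ℝ) :
    -1 ≤ diffCDF μ ν t := by
  have h1 : ν.real (Iic t) ≤ 1 := measureReal_le_one
  have h2 : 0 ≤ μ.real (Iic t) := measureReal_nonneg
  rw [diffCDF]; linarith

lemma bddBelow_diffCDF_image (μ ν : Measure ℝ) [IsProbabilityMeasure ν] (s : Set ℝ) :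
    BddBelow (diffCDF μ ν '' s) := by
  refine ⟨-1, ?_⟩
  rintro _ ⟨t, -, rfl⟩
  exact neg_one_le_diffCDF μ ν t

/-- In a plan concentrated on a laminar set of routes, the mass that passes rightwards over a
segment is the minimum of `F` on this segment. -/
theorem measure_Iic_prod_Ioi {μ ν : Measure ℝ} [IsProbabilityMeasure μ] [IsProbabilityMeasure ν]
    {π : Measure (ℝ × ℝ)} (hπ : π ∈ Marg μ ν) {S : Set (ℝ × ℝ)} (hS : π Sᶜ = 0)
    (h1 : NoOppositeOverlap S) (h2 : RightwardLaminar S) {a b : ℝ} (hab : a ≤ b) :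
    π (Iic a ×ˢ Ioi b) = ENNReal.ofReal (sInf (diffCDF μ ν '' Icc a b)) := by
  have := isProbabilityMeasure_of_mem_marg hπ
  have hmono : ∀ A B : Set (ℝ × ℝ), S ∩ A ⊆ B → π.real A ≤ π.real B := by
    intro A B hAB
    refine ENNReal.toReal_mono (measure_ne_top _ _) ?_
    refine measure_mono_ae ?_
    filter_upwards [compl_mem_ae_iff.2 hS] with z hz hzA
    exact hAB ⟨not_not.1 hz, hzA⟩
  have hFle : ∀ t, diffCDF μ ν t ≤ π.real (Iic t ×ˢ Ioi t) := by
    intro t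
    rw [diffCDF_eq_of_mem_marg hπ]
    linarith [measureReal_nonneg (μ := π) (s := Ioi t ×ˢ Iic t)]
  have hsInf : ∀ t ∈ Icc a b, sInf (diffCDF μ ν '' Icc a b) ≤ diffCDF μ ν t := fun t ht =>
    csInf_le (bddBelow_diffCDF_image μ ν _) (mem_image_of_mem _ ht)
  have hle : sInf (diffCDF μ ν '' Icc a b) ≤ π.real (Iic a ×ˢ Ioi b) := by
    -- Landing points in (a, b] of routes from the left of a. By laminarity every route over such a
    -- point also starts left of a. Past the last landing point, such routes end beyond b, so F at
    -- that point bounds the infimum by the wanted mass.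
    set Y : Set ℝ := {y | a < y ∧ y ≤ b ∧ ∃ x ≤ a, (x, y) ∈ S} with hY
    have hYt : ∀ y ∈ Y, π.real (Iic y ×ˢ Ioi y) ≤ π.real (Iic a ×ˢ Ioi y) := by
      rintro y ⟨hy1, hy2, x, hx, hxy⟩
      refine hmono _ _ ?_
      rintro z ⟨hzS, hz⟩
      refine ⟨?_, hz.2⟩
      by_contra hza
      exact h2 _ hxy _ hzS (hx.trans_lt (not_le.1 hza)) hz.1 hz.2
    rcases Y.eq_empty_or_nonempty with hYe | hYne
    · refine ((hsInf a ⟨le_rfl, hab⟩).trans (hFle a)).trans (hmono _ _ ?_)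
      rintro z ⟨hzS, hz⟩
      refine ⟨hz.1, ?_⟩
      by_contra hzb
      exact (hYe.subset ⟨hz.2, not_lt.1 hzb, z.1, hz.1, hzS⟩ : z.2 ∈ (∅ : Set ℝ))
    · have hbdd : BddAbove Y := ⟨b, fun y hy => hy.2.1⟩
      set s := sSup Y with hs
      have hsb : s ≤ b := csSup_le hYne fun y hy => hy.2.1
      have has : a < s := by
        obtain ⟨y, hy⟩ := hYne
        exact hy.1.trans_le (le_csSup hbdd hy)
      have hend : ∀ z ∈ S, z.1 ≤ a → s < z.2 → b < z.2 := by
        intro z hz hza hzs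
        by_contra hzb
        exact not_lt.2 (le_csSup hbdd ⟨has.trans hzs, not_lt.1 hzb, z.1, hza, hz⟩) hzs
      by_cases hsY : s ∈ Y
      · refine (((hsInf s ⟨has.le, hsb⟩).trans (hFle s)).trans (hYt s hsY)).trans (hmono _ _ ?_)
        rintro z ⟨hzS, hz⟩
        exact ⟨hz.1, hend z hzS hz.1 hz.2⟩
      -- When the supremum is not a landing point, it is approached from the left by landing points,
      -- and continuity from above of π replaces evaluation at it.
      · obtain ⟨u, humono, -, hulim, huY⟩ :=
          (isLUB_csSup hYne hbdd).exists_seq_strictMono_tendsto_of_notMem hsY hYne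
        have hus : ∀ n, u n < s := fun n =>
          lt_of_le_of_ne (le_csSup hbdd (huY n)) fun e => hsY (e ▸ huY n)
        have hlim : Tendsto (fun n => π.real (Iic a ×ˢ Ioi (u n))) atTop
            (𝓝 (π.real (⋂ n, Iic a ×ˢ Ioi (u n)))) := by
          refine (ENNReal.tendsto_toReal (measure_ne_top _ _)).comp ?_
          refine tendsto_measure_iInter_atTop
            (fun n => (measurableSet_Iic.prod measurableSet_Ioi).nullMeasurableSet) ?_
            ⟨0, measure_ne_top _ _⟩
          exact fun m n hmn => prod_mono_right (Ioi_subset_Ioi (humono.monotone hmn))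
        refine (le_of_tendsto_of_tendsto' tendsto_const_nhds hlim fun n =>
          ((hsInf (u n) ⟨(huY n).1.le, (huY n).2.1⟩).trans (hFle (u n))).trans
            (hYt (u n) (huY n))).trans (hmono _ _ ?_)
        rintro z ⟨hzS, hz⟩
        rw [mem_iInter] at hz
        have hsz : s ≤ z.2 := le_of_tendsto' hulim fun n => (hz n).2.le
        refine ⟨(hz 0).1, ?_⟩
        rcases hsz.lt_or_eq with h | h
        · exact hend z hzS (hz 0).1 h
        · exact (hsY ⟨has, hsb, z.1, (hz 0).1, by rw [h]; exact hzS⟩).elim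
  by_cases hemp : S ∩ (Iic a ×ˢ Ioi b) = ∅
  · have h0 : π (Iic a ×ˢ Ioi b) = 0 := by
      refine measure_mono_null ?_ hS
      intro z hz hzS
      exact (hemp.subset ⟨hzS, hz⟩ : z ∈ (∅ : Set (ℝ × ℝ)))
    rw [measureReal_def, h0, ENNReal.toReal_zero] at hle
    rw [h0, ENNReal.ofReal_of_nonpos hle]
  · obtain ⟨z, hzS, hz⟩ := nonempty_iff_ne_empty.2 hemp
    -- One rightward route over all of [a, b] excludes leftward routes over any t in it, so F t is
    -- exactly the rightward mass over t.
    have hge : π.real (Iic a ×ˢ Ioi b) ≤ sInf (diffCDF μ ν '' Icc a b) := by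
      refine le_csInf ((nonempty_Icc.2 hab).image _) ?_
      rintro _ ⟨t, ht, rfl⟩
      rw [diffCDF_eq_of_mem_marg hπ]
      have h0 : π.real (Ioi t ×ˢ Iic t) ≤ π.real ∅ := by
        refine hmono _ _ ?_
        rintro w ⟨hwS, hw⟩
        exact (h1 z hzS w hwS t (le_trans hz.1 ht.1) (lt_of_le_of_lt ht.2 hz.2) hw.2 hw.1).elim
      rw [measureReal_empty] at h0
      have h3 : π.real (Iic a ×ˢ Ioi b) ≤ π.real (Iic t ×ˢ Ioi t) :=
        measureReal_mono (prod_mono (Iic_subset_Iic.2 ht.1) (Ioi_subset_Ioi ht.2))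
      linarith
    rw [← le_antisymm hge hle, ofReal_measureReal]

/-! ### Level sets of a càdlàg function that vanishes at infinity -/

/-- Càdlàg functions that vanish at infinity. -/
structure IsCadlagVanishing (F : ℝ → ℝ) : Prop where
  tendsto_right : ∀ x, Tendsto F (𝓝[>] x) (𝓝 (F x))
  tendsto_left : ∀ x, Tendsto F (𝓝[<] x) (𝓝 (Function.leftLim F x))
  tendsto_atBot : Tendsto F atBot (𝓝 0)
  tendsto_atTop : Tendsto F atTop (𝓝 0)

/-- The generalized solutions of `F = h`. -/
def levelSet (F : ℝ → ℝ) (h : ℝ) : Set ℝ := {x | (x, h) ∈ completedGraph F}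

lemma mem_levelSet {F : ℝ → ℝ} {h x : ℝ} :
    x ∈ levelSet F h ↔ h ∈ uIcc (Function.leftLim F x) (F x) := Iff.rfl

lemma IsCadlagVanishing.leftLim_neg {F : ℝ → ℝ} (hF : IsCadlagVanishing F) (x : ℝ) :
    Function.leftLim (fun t => -F t) x = -Function.leftLim F x :=
  leftLim_eq_of_tendsto (hF.tendsto_left x).neg

lemma IsCadlagVanishing.neg {F : ℝ → ℝ} (hF : IsCadlagVanishing F) :
    IsCadlagVanishing fun t => -F t where
  tendsto_right x := (hF.tendsto_right x).neg
  tendsto_left x := by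
    rw [hF.leftLim_neg]
    exact (hF.tendsto_left x).neg
  tendsto_atBot := by simpa using hF.tendsto_atBot.neg
  tendsto_atTop := by simpa using hF.tendsto_atTop.neg

lemma IsCadlagVanishing.mem_completedGraph_neg {F : ℝ → ℝ} (hF : IsCadlagVanishing F) (x h : ℝ) :
    (x, -h) ∈ completedGraph (fun t => -F t) ↔ (x, h) ∈ completedGraph F := by
  change -h ∈ uIcc (Function.leftLim (fun t => -F t) x) (-F x) ↔ h ∈ uIcc (Function.leftLim F x) (F x)
  rw [hF.leftLim_neg, ← Set.neg_uIcc, Set.neg_mem_neg]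

lemma isCadlagVanishing_diffCDF (μ ν : Measure ℝ) [IsProbabilityMeasure μ]
    [IsProbabilityMeasure ν] : IsCadlagVanishing (diffCDF μ ν) := by
  have e : diffCDF μ ν = fun t => ProbabilityTheory.cdf μ t - ProbabilityTheory.cdf ν t := by
    funext t
    rw [ProbabilityTheory.cdf_eq_real, ProbabilityTheory.cdf_eq_real, diffCDF]
  have hl : ∀ x, Tendsto (diffCDF μ ν) (𝓝[<] x)
      (𝓝 (Function.leftLim (ProbabilityTheory.cdf μ) x -
        Function.leftLim (ProbabilityTheory.cdf ν) x)) := by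
    intro x
    rw [e]
    exact ((ProbabilityTheory.cdf μ).mono.tendsto_leftLim x).sub
      ((ProbabilityTheory.cdf ν).mono.tendsto_leftLim x)
  refine ⟨fun x => ?_, fun x => ?_, ?_, ?_⟩
  · rw [e]
    exact ((((ProbabilityTheory.cdf μ).right_continuous x).mono Ioi_subset_Ici_self).tendsto).sub
      ((((ProbabilityTheory.cdf ν).right_continuous x).mono Ioi_subset_Ici_self).tendsto)
  · rw [leftLim_eq_of_tendsto (hl x)]
    exact hl x
  · rw [e]
    simpa using (ProbabilityTheory.tendsto_cdf_atBot μ).sub (ProbabilityTheory.tendsto_cdf_atBot ν)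
  · rw [e]
    simpa using (ProbabilityTheory.tendsto_cdf_atTop μ).sub (ProbabilityTheory.tendsto_cdf_atTop ν)

/-- Intermediate value theorem for the completed graph. -/
lemma IsCadlagVanishing.exists_mem_levelSet {F : ℝ → ℝ} (hF : IsCadlagVanishing F) {a b h : ℝ}
    (hab : a ≤ b) (ha : F a < h) (hb : h < F b) : ∃ x ∈ Ioc a b, x ∈ levelSet F h := by
  -- At the infimum of this set, right continuity gives F ≥ h, while the left limit is at most h.
  set T : Set ℝ := {t ∈ Icc a b | h < F t} with hT
  have hbT : b ∈ T := ⟨⟨hab, le_rfl⟩, hb⟩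
  have hbdd : BddBelow T := ⟨a, fun t ht => ht.1.1⟩
  set x := sInf T with hx
  have hax : a ≤ x := le_csInf ⟨b, hbT⟩ fun t ht => ht.1.1
  have hxb : x ≤ b := csInf_le hbdd hbT
  have hlow : ∀ t ∈ Icc a b, t < x → F t ≤ h := fun t ht htx => by
    by_contra hlt
    exact not_lt.2 (csInf_le hbdd ⟨ht, not_le.1 hlt⟩) htx
  have hFx : h ≤ F x := by
    by_contra hlt
    have hev := (hF.tendsto_right x).eventually (gt_mem_nhds (not_le.1 hlt))
    obtain ⟨u, hu, hu'⟩ := mem_nhdsGT_iff_exists_Ioo_subset.1 hev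
    obtain ⟨t, ht, htu⟩ := exists_lt_of_csInf_lt ⟨b, hbT⟩ (show sInf T < u from hu)
    rcases (csInf_le hbdd ht).lt_or_eq with h1 | h1
    · have : F t < h := hu' ⟨h1, htu⟩
      exact absurd ht.2 (not_lt.2 this.le)
    · have h2 := ht.2
      rw [← h1] at h2
      exact hlt h2.le
  have hne : a ≠ x := by
    intro e
    rw [← e] at hFx
    exact not_lt.2 hFx ha
  have hlt : a < x := lt_of_le_of_ne hax hne
  refine ⟨x, ⟨hlt, hxb⟩, mem_levelSet.2 ?_⟩
  have hle : Function.leftLim F x ≤ h := by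
    refine le_of_tendsto (hF.tendsto_left x) ?_
    filter_upwards [Ioo_mem_nhdsLT hlt] with t ht
    exact hlow t ⟨ht.1.le, ht.2.le.trans hxb⟩ ht.2
  exact mem_uIcc.2 (Or.inl ⟨hle, hFx⟩)

lemma IsCadlagVanishing.levelSet_neg {F : ℝ → ℝ} (hF : IsCadlagVanishing F) (h : ℝ) :
    levelSet (fun t => -F t) (-h) = levelSet F h := by
  ext x
  exact hF.mem_completedGraph_neg x h

lemma IsCadlagVanishing.exists_mem_levelSet' {F : ℝ → ℝ} (hF : IsCadlagVanishing F) {a b h : ℝ}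
    (hab : a ≤ b) (ha : h < F a) (hb : F b < h) : ∃ x ∈ Ioc a b, x ∈ levelSet F h := by
  rw [← hF.levelSet_neg]
  exact hF.neg.exists_mem_levelSet hab (neg_lt_neg ha) (neg_lt_neg hb)

lemma apply_ne_of_notMem_levelSet {F : ℝ → ℝ} {h t : ℝ} (ht : t ∉ levelSet F h) : F t ≠ h :=
  fun e => ht (mem_levelSet.2 (e ▸ right_mem_uIcc))

lemma IsCadlagVanishing.sign_const {F : ℝ → ℝ} (hF : IsCadlagVanishing F) {a b h : ℝ}
    (hab : a ≤ b) (hL : ∀ t ∈ Icc a b, t ∉ levelSet F h) : h < F a ↔ h < F b := by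
  have ha := apply_ne_of_notMem_levelSet (hL a ⟨le_rfl, hab⟩)
  have hb := apply_ne_of_notMem_levelSet (hL b ⟨hab, le_rfl⟩)
  constructor <;> intro h1 <;> by_contra h2
  · obtain ⟨x, hx, hxL⟩ := hF.exists_mem_levelSet' hab h1 (lt_of_le_of_ne (not_lt.1 h2) hb)
    exact hL x ⟨hx.1.le, hx.2⟩ hxL
  · obtain ⟨x, hx, hxL⟩ := hF.exists_mem_levelSet hab (lt_of_le_of_ne (not_lt.1 h2) ha) h1
    exact hL x ⟨hx.1.le, hx.2⟩ hxL

/-- The vertical segment over t avoids h, hence lies entirely on the side of F t. -/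
lemma lt_of_notMem_levelSet {F : ℝ → ℝ} {h t h' : ℝ} (ht : t ∉ levelSet F h) (hFt : F t < h)
    (hg : (t, h') ∈ completedGraph F) : h' < h := by
  have hg' : h' ∈ uIcc (Function.leftLim F t) (F t) := hg
  rw [mem_levelSet, mem_uIcc] at ht
  rw [mem_uIcc] at hg'
  push Not at ht
  rcases hg' with h1 | h1
  · exact h1.2.trans_lt hFt
  · by_contra hlt
    exact not_lt.2 ((not_lt.1 hlt).trans h1.2) (ht.2 hFt.le)

lemma gt_of_notMem_levelSet {F : ℝ → ℝ} {h t h' : ℝ} (ht : t ∉ levelSet F h) (hFt : h < F t)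
    (hg : (t, h') ∈ completedGraph F) : h < h' := by
  have hg' : h' ∈ uIcc (Function.leftLim F t) (F t) := hg
  rw [mem_levelSet, mem_uIcc] at ht
  rw [mem_uIcc] at hg'
  push Not at ht
  rcases hg' with h1 | h1
  · by_contra hlt
    exact not_lt.2 hFt.le (ht.1 (h1.1.trans (not_lt.1 hlt)))
  · exact hFt.trans_le h1.1

/-! ### Regular levels -/

/-- The graph stays strictly on one side of the height `h` around its point over `x`. -/
def IsOneSided (F : ℝ → ℝ) (h x : ℝ) : Prop :=
  ∃ r s : ℚ, (r : ℝ) < x ∧ x < s ∧ ((∀ t ∈ Ioo (r : ℝ) s, t ≠ x → h < F t) ∨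
    ∀ t ∈ Ioo (r : ℝ) s, t ≠ x → F t < h)

/-- Levels with finitely many generalized solutions, each of which is crossed. -/
structure IsRegularLevel (F : ℝ → ℝ) (h : ℝ) : Prop where
  finite : (levelSet F h).Finite
  crossing : ∀ x ∈ levelSet F h, ¬ IsOneSided F h x

lemma IsRegularLevel.neg {F : ℝ → ℝ} (hF : IsCadlagVanishing F) {h : ℝ}
    (hh : IsRegularLevel F h) : IsRegularLevel (fun t => -F t) (-h) := by
  refine ⟨by rw [hF.levelSet_neg]; exact hh.finite, fun x hx hos => ?_⟩
  rw [hF.levelSet_neg] at hx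
  obtain ⟨r, s, hr, hs, hside⟩ := hos
  refine hh.crossing x hx ⟨r, s, hr, hs, ?_⟩
  rcases hside with h1 | h1
  · exact Or.inr fun t ht htx => neg_lt_neg_iff.1 (h1 t ht htx)
  · exact Or.inl fun t ht htx => neg_lt_neg_iff.1 (h1 t ht htx)

/-- An enumeration of the generalized solutions of `F = h`. -/
structure IsEnumeration (F : ℝ → ℝ) (h : ℝ) {N : ℕ} (x : Fin N → ℝ) : Prop where
  strictMono : StrictMono x
  range_eq : range x = levelSet F h

lemma horizontalLine_inter (F : ℝ → ℝ) (h : ℝ) :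
    horizontalLine h ∩ completedGraph F = levelSet F h ×ˢ {h} := by
  ext ⟨t, k⟩
  constructor
  · rintro ⟨⟨-, hk⟩, hg⟩
    have hk' : k = h := hk
    subst hk'
    exact ⟨hg, rfl⟩
  · rintro ⟨hg, hk⟩
    have hk' : k = h := hk
    subst hk'
    exact ⟨⟨mem_univ _, rfl⟩, hg⟩

lemma prod_singleton_inj {s t : Set ℝ} {h : ℝ} : s ×ˢ {h} = t ×ˢ {h} ↔ s = t := by
  refine ⟨fun e => ?_, fun e => by rw [e]⟩
  ext x
  have := Set.ext_iff.1 e (x, h)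
  simpa using this

lemma IsRegularLevel.exists_enumeration {F : ℝ → ℝ} {h : ℝ} (hh : IsRegularLevel F h) :
    ∃ (N : ℕ) (x : Fin N → ℝ), IsEnumeration F h x := by
  refine ⟨hh.finite.toFinset.card, hh.finite.toFinset.orderEmbOfFin rfl,
    (hh.finite.toFinset.orderEmbOfFin rfl).strictMono, ?_⟩
  rw [Finset.range_orderEmbOfFin, Finite.coe_toFinset]

/-- The points of the gap number `i` between the points of the enumeration `x`. -/
def gap {N : ℕ} (x : Fin N → ℝ) (i : ℕ) : Set ℝ :=
  {t | (∀ j : Fin N, (j : ℕ) < i → x j < t) ∧ ∀ j : Fin N, i ≤ (j : ℕ) → t < x j}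

/-! ### Alternation of the gaps at a regular level -/

section Enumeration

variable {F : ℝ → ℝ} {h : ℝ} {N : ℕ} {x : Fin N → ℝ}

lemma IsEnumeration.notMem_of_mem_gap (hx : IsEnumeration F h x) {i : ℕ} {t : ℝ}
    (ht : t ∈ gap x i) : t ∉ levelSet F h := by
  rw [← hx.range_eq]
  rintro ⟨j, rfl⟩
  rcases lt_or_ge (j : ℕ) i with hj | hj
  · exact lt_irrefl _ (ht.1 j hj)
  · exact lt_irrefl _ (ht.2 j hj)

lemma ordConnected_gap (x : Fin N → ℝ) (i : ℕ) {s t u : ℝ} (hs : s ∈ gap x i) (ht : t ∈ gap x i)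
    (hu : u ∈ Icc s t) : u ∈ gap x i :=
  ⟨fun j hj => (hs.1 j hj).trans_le hu.1, fun j hj => hu.2.trans_lt (ht.2 j hj)⟩

lemma IsEnumeration.sign_const (hF : IsCadlagVanishing F) (hx : IsEnumeration F h x) {i : ℕ}
    {s t : ℝ} (hs : s ∈ gap x i) (ht : t ∈ gap x i) : h < F s ↔ h < F t := by
  rcases le_total s t with hst | hst
  · exact hF.sign_const hst fun u hu => hx.notMem_of_mem_gap (ordConnected_gap x i hs ht hu)
  · exact (hF.sign_const hst fun u hu =>
      hx.notMem_of_mem_gap (ordConnected_gap x i ht hs hu)).symm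

lemma IsEnumeration.eventually_left (hx : IsEnumeration F h x) (i : Fin N) :
    ∃ r < x i, ∀ t ∈ Ioo r (x i), t ∈ gap x i := by
  have hev : ∀ᶠ r in 𝓝[<] (x i), ∀ j : Fin N, j < i → x j < r :=
    eventually_all.2 fun j => by
      by_cases hj : j < i
      · exact ((lt_mem_nhds (hx.strictMono hj)).filter_mono nhdsWithin_le_nhds).mono fun r hr _ => hr
      · exact Eventually.of_forall fun r hj' => (hj hj').elim
  obtain ⟨r, hr, hr'⟩ := (hev.and self_mem_nhdsWithin).exists
  exact ⟨r, hr', fun t ht => ⟨fun j hj => (hr j hj).trans ht.1, fun j hj =>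
    ht.2.trans_le (hx.strictMono.monotone (Fin.le_def.2 hj))⟩⟩

lemma IsEnumeration.eventually_right (hx : IsEnumeration F h x) (i : Fin N) :
    ∃ s > x i, ∀ t ∈ Ioo (x i) s, t ∈ gap x (i + 1) := by
  have hev : ∀ᶠ s in 𝓝[>] (x i), ∀ j : Fin N, i < j → s < x j :=
    eventually_all.2 fun j => by
      by_cases hj : i < j
      · exact ((gt_mem_nhds (hx.strictMono hj)).filter_mono nhdsWithin_le_nhds).mono fun r hr _ => hr
      · exact Eventually.of_forall fun r hj' => (hj hj').elim
  obtain ⟨s, hs, hs'⟩ := (hev.and self_mem_nhdsWithin).exists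
  exact ⟨s, hs', fun t ht => ⟨fun j hj =>
    (hx.strictMono.monotone (Fin.le_def.2 (Nat.lt_succ_iff.1 hj))).trans_lt ht.1,
    fun j hj => ht.2.trans (hs j (Fin.lt_def.2 hj))⟩⟩

lemma IsEnumeration.isOneSided_of_gaps (hF : IsCadlagVanishing F) (hx : IsEnumeration F h x)
    (i : Fin N) {t u : ℝ} (ht : t ∈ gap x i) (hu : u ∈ gap x (i + 1))
    (heq : h < F t ↔ h < F u) : IsOneSided F h (x i) := by
  obtain ⟨r, hr, hr'⟩ := hx.eventually_left i
  obtain ⟨s, hs, hs'⟩ := hx.eventually_right i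
  obtain ⟨r', hr1, hr2⟩ := exists_rat_btwn hr
  obtain ⟨s', hs1, hs2⟩ := exists_rat_btwn hs
  refine ⟨r', s', hr2, hs1, ?_⟩
  have key : ∀ w ∈ Ioo (r' : ℝ) s', w ≠ x i → ((h < F w ↔ h < F t) ∧ w ∉ levelSet F h) := by
    intro w hw hwx
    rcases lt_or_gt_of_ne hwx with h1 | h1
    · have hg := hr' w ⟨hr1.trans hw.1, h1⟩
      exact ⟨hx.sign_const hF hg ht, hx.notMem_of_mem_gap hg⟩
    · have hg := hs' w ⟨h1, hw.2.trans hs2⟩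
      exact ⟨(hx.sign_const hF hg hu).trans heq.symm, hx.notMem_of_mem_gap hg⟩
  by_cases hFt : h < F t
  · exact Or.inl fun w hw hwx => (key w hw hwx).1.2 hFt
  · exact Or.inr fun w hw hwx => lt_of_le_of_ne
      (not_lt.1 fun hlt => hFt ((key w hw hwx).1.1 hlt))
      (apply_ne_of_notMem_levelSet (key w hw hwx).2)

/-- Above a positive regular level, the gaps are alternately below and above the level. -/
lemma IsEnumeration.sign_gap (hF : IsCadlagVanishing F) (hh : IsRegularLevel F h) (h0 : 0 < h)
    (hx : IsEnumeration F h x) : ∀ i ≤ N, ∀ t ∈ gap x i, (h < F t ↔ Odd i) := by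
  intro i
  induction i with
  | zero =>
    intro _ t ht
    -- F tends to 0 < h at -∞, so being above h in the first gap would force an earlier solution.
    refine iff_of_false (fun hlt => ?_) (by simp)
    obtain ⟨s, hs, hst⟩ := ((hF.tendsto_atBot.eventually (gt_mem_nhds h0)).and
      (eventually_le_atBot t)).exists
    obtain ⟨y, hy, hyL⟩ := hF.exists_mem_levelSet hst hs hlt
    rw [← hx.range_eq] at hyL
    obtain ⟨j, rfl⟩ := hyL
    exact not_lt.2 hy.2 (ht.2 j (Nat.zero_le _))
  | succ i ih =>
    intro hi t ht
    obtain ⟨r, hr, hr'⟩ := hx.eventually_left ⟨i, hi⟩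
    obtain ⟨u, hu⟩ := exists_between hr
    have hug := hr' u hu
    rw [Nat.odd_add_one, ← ih (Nat.le_of_succ_le hi) u hug]
    by_contra hne
    refine hh.crossing _ (hx.range_eq ▸ mem_range_self _)
      (hx.isOneSided_of_gaps hF ⟨i, hi⟩ hug ht ?_)
    tauto

/-- The last gap has number N and is below h, since F tends to 0 at +∞. -/
lemma IsEnumeration.even (hF : IsCadlagVanishing F) (hh : IsRegularLevel F h) (h0 : 0 < h)
    (hx : IsEnumeration F h x) : Even N := by
  have hev : ∀ᶠ t in atTop, ∀ j : Fin N, x j < t :=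
    eventually_all.2 fun j => eventually_gt_atTop (x j)
  obtain ⟨t, ht, htF⟩ := (hev.and (hF.tendsto_atTop.eventually (gt_mem_nhds h0))).exists
  rw [← Nat.not_odd_iff_even, ← hx.sign_gap hF hh h0 N le_rfl t
    ⟨fun j _ => ht j, fun j hj => (not_lt.2 hj j.2).elim⟩]
  exact not_lt.2 htF.le

/-- A finite set has only one increasing enumeration, so the existential choice in `excursionPairs`
is forced. -/
lemma IsEnumeration.excursionPairs_eq (hx : IsEnumeration F h x) :
    excursionPairs F h = {z | ∃ (k : ℕ) (hk : 2 * k + 1 < N),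
      z = (x ⟨2 * k, by omega⟩, x ⟨2 * k + 1, hk⟩)} := by
  ext z
  constructor
  · rintro ⟨N', x', hx', he, hz⟩
    rw [horizontalLine_inter, prod_singleton_inj, ← hx.range_eq] at he
    have hN : N = N' := by
      have := congrArg Set.ncard he
      rwa [← image_univ, ← image_univ, ncard_image_of_injective _ hx.strictMono.injective,
        ncard_image_of_injective _ hx'.injective, ncard_univ, ncard_univ, Nat.card_fin,
        Nat.card_fin] at this
    subst hN
    rw [hx.strictMono.range_inj hx'] at he
    subst he
    exact hz
  · intro hz
    exact ⟨N, x, hx.strictMono, by rw [horizontalLine_inter, hx.range_eq], hz⟩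

lemma IsEnumeration.encard_excursionPairs (hF : IsCadlagVanishing F) (hh : IsRegularLevel F h)
    (h0 : 0 < h) (hx : IsEnumeration F h x) : 2 * (excursionPairs F h).encard = N := by
  obtain ⟨M, rfl⟩ := hx.even hF hh h0
  have e : excursionPairs F h = range fun k : Fin M =>
      (x ⟨2 * (k : ℕ), by omega⟩, x ⟨2 * (k : ℕ) + 1, by omega⟩) := by
    rw [hx.excursionPairs_eq]
    ext z
    constructor
    · rintro ⟨k, hk, rfl⟩
      exact ⟨⟨k, by omega⟩, rfl⟩
    · rintro ⟨k, rfl⟩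
      exact ⟨k, by omega, rfl⟩
  have hinj : Function.Injective fun k : Fin M =>
      (x ⟨2 * (k : ℕ), by omega⟩, x ⟨2 * (k : ℕ) + 1, by omega⟩) := by
    intro k k' hkk
    have := hx.strictMono.injective (Prod.mk.inj hkk).1
    simp only [Fin.mk.injEq] at this
    exact Fin.ext (by omega)
  rw [e, ← image_univ, hinj.encard_image, encard_univ, ENat.card_eq_coe_fintype_card,
    Fintype.card_fin]
  push_cast
  ring

end Enumeration

lemma disjoint_increasing_decreasing (F : ℝ → ℝ) :
    Disjoint (increasingPoints F) (decreasingPoints F) := by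
  rw [Set.disjoint_left]
  rintro z ⟨-, U, hU, hU'⟩ ⟨-, V, hV, hV'⟩
  have hUV : ∀ᶠ t in 𝓝[≠] z.1, t ∈ U ∩ V := mem_nhdsWithin_of_mem_nhds (inter_mem hU hV)
  have hne : ∀ᶠ t in 𝓝[≠] z.1, t ≠ z.1 := self_mem_nhdsWithin
  obtain ⟨t, ht, htz⟩ := (hUV.and hne).exists
  have hg : (t, F t) ∈ completedGraph F := right_mem_uIcc
  exact lt_asymm (hU' _ hg ⟨ht.1, htz⟩) (hV' _ hg ⟨ht.2, htz⟩)

lemma IsRegularLevel.mem_increasing_or_decreasing {F : ℝ → ℝ} (hF : IsCadlagVanishing F) {h : ℝ}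
    (hh : IsRegularLevel F h) (h0 : 0 < h) {t : ℝ} (ht : t ∈ levelSet F h) :
    (t, h) ∈ increasingPoints F ∪ decreasingPoints F := by
  obtain ⟨N, x, hx⟩ := hh.exists_enumeration
  have ht' := ht
  rw [← hx.range_eq] at ht'
  obtain ⟨i, rfl⟩ := ht'
  obtain ⟨r, hr, hr'⟩ := hx.eventually_left i
  obtain ⟨s, hs, hs'⟩ := hx.eventually_right i
  have hsg := hx.sign_gap hF hh h0
  have hle : ∀ w ∈ gap x i, ¬ Odd (i : ℕ) → F w < h := fun w hw ho =>
    lt_of_le_of_ne (not_lt.1 fun hlt => ho ((hsg i i.2.le w hw).1 hlt))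
      (apply_ne_of_notMem_levelSet (hx.notMem_of_mem_gap hw))
  have hle' : ∀ w ∈ gap x (i + 1), Odd (i : ℕ) → F w < h := fun w hw ho =>
    lt_of_le_of_ne (not_lt.1 fun hlt => (Nat.odd_add_one.1 ((hsg (i + 1) i.2 w hw).1 hlt)) ho)
      (apply_ne_of_notMem_levelSet (hx.notMem_of_mem_gap hw))
  -- With indices starting at 0, gap `i` lies just left of `x i`: for odd `i` the graph comes from
  -- above, for even `i` from below.
  by_cases ho : Odd (i : ℕ)
  · refine Or.inr ⟨ht, Ioo r s, Ioo_mem_nhds hr hs, ?_⟩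
    rintro ⟨w, k⟩ hg ⟨hw, hwx⟩
    have hwx' : w ≠ x i := hwx
    rcases lt_or_gt_of_ne hwx' with h1 | h1
    · have hgap := hr' w ⟨hw.1, h1⟩
      exact mul_neg_of_pos_of_neg (sub_pos.2 (gt_of_notMem_levelSet (hx.notMem_of_mem_gap hgap)
        ((hsg i i.2.le w hgap).2 ho) hg)) (sub_neg.2 h1)
    · have hgap := hs' w ⟨h1, hw.2⟩
      exact mul_neg_of_neg_of_pos (sub_neg.2 (lt_of_notMem_levelSet (hx.notMem_of_mem_gap hgap)
        (hle' w hgap ho) hg)) (sub_pos.2 h1)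
  · refine Or.inl ⟨ht, Ioo r s, Ioo_mem_nhds hr hs, ?_⟩
    rintro ⟨w, k⟩ hg ⟨hw, hwx⟩
    have hwx' : w ≠ x i := hwx
    rcases lt_or_gt_of_ne hwx' with h1 | h1
    · have hgap := hr' w ⟨hw.1, h1⟩
      exact mul_pos_of_neg_of_neg (sub_neg.2 (lt_of_notMem_levelSet (hx.notMem_of_mem_gap hgap)
        (hle w hgap ho) hg)) (sub_neg.2 h1)
    · have hgap := hs' w ⟨h1, hw.2⟩
      exact mul_pos (sub_pos.2 (gt_of_notMem_levelSet (hx.notMem_of_mem_gap hgap)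
        ((hsg (i + 1) i.2 w hgap).2 (Nat.odd_add_one.2 ho)) hg)) (sub_pos.2 h1)

/-- All N solutions are increasing or decreasing points, never both, and they form N / 2 pairs. -/
lemma IsRegularLevel.crossingCount_eq {F : ℝ → ℝ} (hF : IsCadlagVanishing F) {h : ℝ}
    (hh : IsRegularLevel F h) (h0 : 0 < h) :
    crossingCount F h = 2 * ((excursionPairs F h).encard : ℝ≥0∞) := by
  obtain ⟨N, x, hx⟩ := hh.exists_enumeration
  have e : (horizontalLine h ∩ increasingPoints F).encard +
      (horizontalLine h ∩ decreasingPoints F).encard = 2 * (excursionPairs F h).encard := by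
    rw [← encard_union_eq ((disjoint_increasing_decreasing F).mono inter_subset_right
      inter_subset_right), ← inter_union_distrib_left, hx.encard_excursionPairs hF hh h0]
    have e2 : horizontalLine h ∩ (increasingPoints F ∪ decreasingPoints F) =
        (fun t => (t, h)) '' range x := by
      rw [hx.range_eq]
      ext ⟨t, k⟩
      constructor
      · rintro ⟨hk, hg⟩
        have hg' : (t, k) ∈ completedGraph F := hg.elim (fun w => w.1) fun w => w.1
        have hm : (t, k) ∈ levelSet F h ×ˢ {h} := by
          rw [← horizontalLine_inter]; exact ⟨hk, hg'⟩
        exact ⟨t, hm.1, Prod.ext rfl (Eq.symm hm.2)⟩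
      · rintro ⟨t', ht', e⟩
        obtain ⟨rfl, rfl⟩ := Prod.mk.inj e
        exact ⟨⟨mem_univ _, rfl⟩, hh.mem_increasing_or_decreasing hF h0 ht'⟩
    rw [e2, Function.Injective.encard_image (fun a b hab => (Prod.mk.inj hab).1),
      ← image_univ, hx.strictMono.injective.encard_image, encard_univ,
      ENat.card_eq_coe_fintype_card, Fintype.card_fin]
  have := congrArg (fun n : ℕ∞ => (n : ℝ≥0∞)) e
  simpa [crossingCount] using this

/-! ### Excursions over a segment -/

section Enumeration

variable {F : ℝ → ℝ} {h : ℝ} {N : ℕ} {x : Fin N → ℝ}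

/-- Looking just to the right of a allows a itself to be a solution. -/
lemma IsEnumeration.exists_gap_right (hx : IsEnumeration F h x) (a : ℝ) :
    ∃ i ≤ N, (∀ j : Fin N, (j : ℕ) < i → x j ≤ a) ∧ (∀ j : Fin N, i ≤ (j : ℕ) → a < x j) ∧
      ∀ᶠ t in 𝓝[>] a, t ∈ gap x i := by
  classical
  have hex : ∃ i, ∀ j : Fin N, i ≤ (j : ℕ) → a < x j := ⟨N, fun j hj => (not_lt.2 hj j.2).elim⟩
  have hlow : ∀ j : Fin N, (j : ℕ) < Nat.find hex → x j ≤ a := by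
    intro j hj
    have := Nat.find_min hex hj
    push Not at this
    obtain ⟨j', hj', hle⟩ := this
    exact (hx.strictMono.monotone (Fin.le_def.2 hj')).trans hle
  refine ⟨Nat.find hex, Nat.find_min' hex fun j hj => (not_lt.2 hj j.2).elim, hlow,
    Nat.find_spec hex, ?_⟩
  have hev : ∀ᶠ t in 𝓝[>] a, ∀ j : Fin N, Nat.find hex ≤ (j : ℕ) → t < x j :=
    eventually_all.2 fun j => by
      by_cases hj : Nat.find hex ≤ (j : ℕ)
      · exact ((gt_mem_nhds (Nat.find_spec hex j hj)).filter_mono nhdsWithin_le_nhds).mono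
          fun r hr _ => hr
      · exact Eventually.of_forall fun r hj' => (hj hj').elim
  filter_upwards [hev, self_mem_nhdsWithin] with t ht hta
  exact ⟨fun j hj => (hlow j hj).trans_lt hta, ht⟩

end Enumeration

section Levels

variable {F : ℝ → ℝ} {h : ℝ}

lemma IsRegularLevel.finite_excursionPairs (hh : IsRegularLevel F h) :
    (excursionPairs F h).Finite := by
  obtain ⟨N, x, hx⟩ := hh.exists_enumeration
  refine ((finite_range x).prod (finite_range x)).subset ?_
  rw [hx.excursionPairs_eq]
  rintro _ ⟨k, hk, rfl⟩
  exact ⟨mem_range_self _, mem_range_self _⟩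

lemma fst_lt_snd_of_mem_excursionPairs {z : ℝ × ℝ} (hz : z ∈ excursionPairs F h) :
    z.1 < z.2 := by
  obtain ⟨N, x, hx, -, k, hk, rfl⟩ := hz
  exact hx (Fin.lt_def.2 (Nat.lt_succ_self _))

/-- Under an excursion straddling [a, b], F exceeds h just to the right of every t in [a, b]; right
continuity forbids this where F t < h. -/
lemma IsRegularLevel.excursionPairs_inter_eq_empty (hF : IsCadlagVanishing F)
    (hh : IsRegularLevel F h) (h0 : 0 < h) {a b : ℝ} (hab : a ≤ b)
    (hlt : sInf (F '' Icc a b) < h) : excursionPairs F h ∩ Iic a ×ˢ Ioi b = ∅ := by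
  obtain ⟨_, ⟨t, ht, rfl⟩, htF⟩ := exists_lt_of_csInf_lt ((nonempty_Icc.2 hab).image F) hlt
  obtain ⟨N, x, hx⟩ := hh.exists_enumeration
  rw [hx.excursionPairs_eq, eq_empty_iff_forall_notMem]
  rintro _ ⟨⟨k, hk, rfl⟩, hka, hkb⟩
  simp only [mem_Iic, mem_Ioi] at hka hkb
  have hev : ∀ᶠ u in 𝓝[>] t, u ∈ gap x (2 * k + 1) := by
    filter_upwards [Ioo_mem_nhdsGT (ht.2.trans_lt hkb)] with u hu
    refine ⟨fun j hj => ?_, fun j hj => ?_⟩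
    · exact ((hx.strictMono.monotone (Fin.le_def.2 (Nat.lt_succ_iff.1 hj))).trans
        (hka.trans ht.1)).trans_lt hu.1
    · exact hu.2.trans_le (hx.strictMono.monotone (Fin.le_def.2 hj))
  obtain ⟨u, hu, huF⟩ := (hev.and ((hF.tendsto_right t).eventually (gt_mem_nhds htF))).exists
  have : h < F u := (hx.sign_gap hF hh h0 _ hk.le u hu).2 (by simp)
  exact lt_asymm this huF

/-- F is above h just right of a, so that gap has an odd number 2k + 1 and pair number k is the only
candidate. -/
lemma IsRegularLevel.encard_excursionPairs_inter (hF : IsCadlagVanishing F)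
    (hh : IsRegularLevel F h) (h0 : 0 < h) {a b : ℝ} (hab : a ≤ b)
    (hbdd : BddBelow (F '' Icc a b))
    (hlt : h < sInf (F '' Icc a b)) : (excursionPairs F h ∩ Iic a ×ˢ Ioi b).encard = 1 := by
  have hFt : ∀ t ∈ Icc a b, sInf (F '' Icc a b) ≤ F t := fun t ht =>
    csInf_le hbdd (mem_image_of_mem F ht)
  obtain ⟨N, x, hx⟩ := hh.exists_enumeration
  obtain ⟨i, hiN, hlow, hup, hgap⟩ := hx.exists_gap_right a
  have hodd : Odd i := by
    obtain ⟨t, ht, htF⟩ := (hgap.and ((hF.tendsto_right a).eventually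
      (lt_mem_nhds (hlt.trans_le (hFt a ⟨le_rfl, hab⟩))))).exists
    exact (hx.sign_gap hF hh h0 i hiN t ht).1 htF
  obtain ⟨k, rfl⟩ := hodd
  have hkN : 2 * k + 1 < N := by
    obtain ⟨M, hM⟩ := hx.even hF hh h0
    omega
  rw [encard_eq_one]
  refine ⟨(x ⟨2 * k, by omega⟩, x ⟨2 * k + 1, hkN⟩), ?_⟩
  rw [hx.excursionPairs_eq]
  ext z
  constructor
  · rintro ⟨⟨k', hk', rfl⟩, ha, hb⟩
    simp only [mem_Iic, mem_Ioi] at ha hb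
    have h1 : 2 * k' < 2 * k + 1 := by
      by_contra hge
      exact not_lt.2 ha (hup _ (not_lt.1 hge))
    have h2 : 2 * k + 1 ≤ 2 * k' + 1 := by
      by_contra hlt'
      exact not_lt.2 ((hlow ⟨2 * k' + 1, hk'⟩ (not_le.1 hlt')).trans hab) hb
    obtain rfl : k' = k := by omega
    rfl
  · rintro rfl
    refine ⟨⟨k, hkN, rfl⟩, hlow _ (Nat.lt_succ_self _), ?_⟩
    have hax := hup ⟨2 * k + 1, hkN⟩ le_rfl
    rw [mem_Ioi]
    by_contra hxb
    have hmem : x ⟨2 * k + 1, hkN⟩ ∈ levelSet F h := hx.range_eq ▸ mem_range_self _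
    -- A solution in (a, b] is impossible: both the value and the left limit there are above h.
    have hl : sInf (F '' Icc a b) ≤ Function.leftLim F (x ⟨2 * k + 1, hkN⟩) := by
      refine ge_of_tendsto (hF.tendsto_left _) ?_
      filter_upwards [Ioo_mem_nhdsLT hax] with t ht
      exact hFt t ⟨ht.1.le, ht.2.le.trans (not_lt.1 hxb)⟩
    have hr := hFt _ ⟨hax.le, not_lt.1 hxb⟩
    rcases mem_uIcc.1 (mem_levelSet.1 hmem) with h1 | h1
    · exact not_lt.2 (hl.trans h1.1) hlt
    · exact not_lt.2 (hr.trans h1.1) hlt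

/-! ### Almost every level is regular -/

/-- A rational window determines the level. If h < h' shared one, F would exceed h' in it except at
one point, and so both one-sided limits at the solution for h would be at least h'. -/
lemma countable_oneSided_above (hF : IsCadlagVanishing F) :
    {h | ∃ x ∈ levelSet F h, ∃ r s : ℚ, (r : ℝ) < x ∧ x < s ∧
      ∀ t ∈ Ioo (r : ℝ) s, t ≠ x → h < F t}.Countable := by
  have hch : ∀ h ∈ {h | ∃ x ∈ levelSet F h, ∃ r s : ℚ, (r : ℝ) < x ∧ x < s ∧
      ∀ t ∈ Ioo (r : ℝ) s, t ≠ x → h < F t}, ∃ r : ℚ × ℚ, ∃ x ∈ levelSet F h, (r.1 : ℝ) < x ∧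
      x < r.2 ∧ ∀ t ∈ Ioo (r.1 : ℝ) r.2, t ≠ x → h < F t := by
    rintro h ⟨x, hx, r, s, h1⟩
    exact ⟨(r, s), x, hx, h1⟩
  choose! f hf using hch
  have key : ∀ {h h' : ℝ} {r s x x' : ℝ}, h < h' → x ∈ levelSet F h → r < x → x < s →
      (∀ t ∈ Ioo r s, t ≠ x' → h' < F t) → False := by
    intro h h' r s x x' hlt hx hr hs hF'
    have h1 : h' ≤ Function.leftLim F x := by
      refine ge_of_tendsto (hF.tendsto_left x) ?_
      have hne : ∀ᶠ t in 𝓝[<] x, t ≠ x' := by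
        rcases lt_or_ge x' x with h2 | h2
        · filter_upwards [Ioo_mem_nhdsLT h2] with t ht using ht.1.ne'
        · filter_upwards [self_mem_nhdsWithin] with t ht using (lt_of_lt_of_le ht h2).ne
      filter_upwards [Ioo_mem_nhdsLT hr, hne] with t ht htx
      exact (hF' t ⟨ht.1, ht.2.trans hs⟩ htx).le
    have h2 : h' ≤ F x := by
      refine ge_of_tendsto (hF.tendsto_right x) ?_
      have hne : ∀ᶠ t in 𝓝[>] x, t ≠ x' := by
        rcases lt_or_ge x x' with h2 | h2
        · filter_upwards [Ioo_mem_nhdsGT h2] with t ht using ht.2.ne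
        · filter_upwards [self_mem_nhdsWithin] with t ht using (lt_of_le_of_lt h2 ht).ne'
      filter_upwards [Ioo_mem_nhdsGT hs, hne] with t ht htx
      exact (hF' t ⟨hr.trans ht.1, ht.2⟩ htx).le
    rcases mem_uIcc.1 (mem_levelSet.1 hx) with h3 | h3
    · exact not_lt.2 (h1.trans h3.1) hlt
    · exact not_lt.2 (h2.trans h3.1) hlt
  refine countable_of_injective_of_countable_image (f := f) (fun h hh h' hh' e => ?_)
    (to_countable _)
  obtain ⟨x, hx, k1, k2, k3⟩ := hf h hh
  obtain ⟨x', hx', k1', k2', k3'⟩ := hf h' hh'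
  rw [← e] at k1' k2' k3'
  rcases lt_trichotomy h h' with hlt | hlt | hlt
  · exact (key hlt hx k1 k2 k3').elim
  · exact hlt
  · exact (key hlt hx' k1' k2' k3).elim

lemma countable_oneSided (hF : IsCadlagVanishing F) :
    {h | ∃ x ∈ levelSet F h, IsOneSided F h x}.Countable := by
  refine ((countable_oneSided_above hF).union
    ((countable_oneSided_above hF.neg).image Neg.neg)).mono ?_
  rintro h ⟨x, hx, r, s, hr, hs, h1 | h1⟩
  · exact Or.inl ⟨x, hx, r, s, hr, hs, h1⟩
  · refine Or.inr ⟨-h, ⟨x, ?_, r, s, hr, hs, fun t ht htx => neg_lt_neg (h1 t ht htx)⟩, neg_neg h⟩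
    rw [hF.levelSet_neg]
    exact hx

end Levels

/-- Over a cell, the levels met by the completed graph lie in an interval of length μ + ν of the
cell. -/
lemma mem_Icc_of_mem_levelSet_diffCDF {μ ν : Measure ℝ} [IsProbabilityMeasure μ]
    [IsProbabilityMeasure ν] {a b x h : ℝ} (hx : x ∈ Ioc a b)
    (hxL : x ∈ levelSet (diffCDF μ ν) h) :
    h ∈ Icc (diffCDF μ ν a - ν.real (Ioc a b)) (diffCDF μ ν a + μ.real (Ioc a b)) := by
  have hsplit : ∀ (ρ : Measure ℝ) [IsProbabilityMeasure ρ] {t : ℝ}, a ≤ t →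
      ρ.real (Iic t) = ρ.real (Iic a) + ρ.real (Ioc a t) := by
    intro ρ _ t ht
    rw [← measureReal_union (Iic_disjoint_Ioc le_rfl) measurableSet_Ioc, Iic_union_Ioc_eq_Iic ht]
  have hmem : ∀ t ∈ Icc a b, diffCDF μ ν t ∈
      Icc (diffCDF μ ν a - ν.real (Ioc a b)) (diffCDF μ ν a + μ.real (Ioc a b)) := by
    intro t ht
    have h1 : μ.real (Ioc a t) ≤ μ.real (Ioc a b) := measureReal_mono (Ioc_subset_Ioc_right ht.2)
    have h2 : ν.real (Ioc a t) ≤ ν.real (Ioc a b) := measureReal_mono (Ioc_subset_Ioc_right ht.2)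
    have h3 : 0 ≤ μ.real (Ioc a t) := measureReal_nonneg
    have h4 : 0 ≤ ν.real (Ioc a t) := measureReal_nonneg
    simp only [diffCDF]
    rw [hsplit μ ht.1, hsplit ν ht.1]
    constructor <;> linarith
  have hF := isCadlagVanishing_diffCDF μ ν
  have hl : Function.leftLim (diffCDF μ ν) x ∈
      Icc (diffCDF μ ν a - ν.real (Ioc a b)) (diffCDF μ ν a + μ.real (Ioc a b)) := by
    refine isClosed_Icc.mem_of_tendsto (hF.tendsto_left x) ?_
    filter_upwards [Ioo_mem_nhdsLT hx.1] with t ht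
    exact hmem t ⟨ht.1.le, ht.2.le.trans hx.2⟩
  exact uIcc_subset_Icc hl (hmem x ⟨hx.1.le, hx.2⟩) hxL

/-- The cell number `j` of the partition of the line with mesh `1 / (n + 1)`. -/
def meshCell (n : ℕ) (j : ℤ) : Set ℝ := Ioc ((j : ℝ) / (n + 1)) ((j + 1 : ℝ) / (n + 1))

lemma mem_meshCell_iff {n : ℕ} {j : ℤ} {x : ℝ} :
    x ∈ meshCell n j ↔ ⌈x * (n + 1)⌉ = j + 1 := by
  have hn : (0 : ℝ) < (n : ℝ) + 1 := by positivity
  rw [meshCell, mem_Ioc, div_lt_iff₀ hn, le_div_iff₀ hn, Int.ceil_eq_iff]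
  push_cast
  rw [add_sub_cancel_right]

lemma tsum_measure_meshCell_le (μ : Measure ℝ) [IsProbabilityMeasure μ] (n : ℕ) :
    ∑' j : ℤ, μ (meshCell n j) ≤ 1 := by
  rw [← measure_univ (μ := μ)]
  refine tsum_measure_le_measure_univ (fun j => measurableSet_Ioc.nullMeasurableSet) ?_
  intro j j' hjj
  refine Disjoint.aedisjoint (Set.disjoint_left.2 fun x hx hx' => hjj ?_)
  rw [mem_meshCell_iff] at hx hx'
  omega

lemma eventually_injOn_meshCell (T : Finset ℝ) :
    ∀ᶠ n : ℕ in atTop, Set.InjOn (fun x : ℝ => ⌈x * (n + 1)⌉ - 1) T := by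
  have hev : ∀ᶠ n : ℕ in atTop, ∀ x ∈ T, ∀ y ∈ T, x ≠ y → 1 ≤ |x - y| * ((n : ℝ) + 1) := by
    refine (eventually_all_finset T).2 fun x _ => (eventually_all_finset T).2 fun y _ => ?_
    by_cases hxy : x = y
    · exact Eventually.of_forall fun n hne => (hne hxy).elim
    · have hlim : Tendsto (fun n : ℕ => |x - y| * ((n : ℝ) + 1)) atTop atTop :=
        (tendsto_natCast_atTop_atTop.atTop_add tendsto_const_nhds).const_mul_atTop
          (abs_pos.2 (sub_ne_zero.2 hxy))
      exact (hlim.eventually_ge_atTop 1).mono fun n hn _ => hn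
  filter_upwards [hev] with n hn x hx y hy hxy
  by_contra hne
  have h1 := hn x hx y hy hne
  have hn0 : (0 : ℝ) < (n : ℝ) + 1 := by positivity
  have hxy' : ⌈x * ((n : ℝ) + 1)⌉ = ⌈y * ((n : ℝ) + 1)⌉ := by
    have hxy2 : ⌈x * ((n : ℝ) + 1)⌉ - 1 = ⌈y * ((n : ℝ) + 1)⌉ - 1 := hxy
    omega
  have a1 := Int.le_ceil (x * ((n : ℝ) + 1))
  have a2 := Int.ceil_lt_add_one (x * ((n : ℝ) + 1))
  have b1 := Int.le_ceil (y * ((n : ℝ) + 1))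
  have b2 := Int.ceil_lt_add_one (y * ((n : ℝ) + 1))
  rw [hxy'] at a1 a2
  rw [← abs_of_pos hn0, ← abs_mul] at h1
  rw [sub_mul] at h1
  rcases abs_cases (x * ((n : ℝ) + 1) - y * ((n : ℝ) + 1)) with h2 | h2 <;> linarith

/-- A Banach indicatrix argument. `g n h` counts the cells whose interval of possible levels
contains h, and has integral at most 2. By Fatou its lower limit is almost everywhere finite. But k
solutions eventually lie in k different cells, so an infinite level set would make this lower limit
infinite. -/
lemma ae_finite_levelSet_diffCDF (μ ν : Measure ℝ) [IsProbabilityMeasure μ]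
    [IsProbabilityMeasure ν] : ∀ᵐ h, (levelSet (diffCDF μ ν) h).Finite := by
  set J : ℕ → ℤ → Set ℝ := fun n j =>
    Icc (diffCDF μ ν ((j : ℝ) / (n + 1)) - ν.real (meshCell n j))
      (diffCDF μ ν ((j : ℝ) / (n + 1)) + μ.real (meshCell n j)) with hJ
  set g : ℕ → ℝ → ℝ≥0∞ := fun n h => ∑' j : ℤ, (J n j).indicator 1 h with hg
  have hgm : ∀ n, Measurable (g n) := fun n =>
    Measurable.tsum fun j => measurable_one.indicator measurableSet_Icc
  have hint : ∀ n, ∫⁻ h, g n h ≤ 2 := by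
    intro n
    simp only [hg]
    rw [lintegral_tsum fun j => (measurable_one.indicator measurableSet_Icc).aemeasurable]
    have e : ∀ j, ∫⁻ h, (J n j).indicator 1 h = μ (meshCell n j) + ν (meshCell n j) := by
      intro j
      rw [lintegral_indicator_one measurableSet_Icc, Real.volume_Icc,
        show diffCDF μ ν ((j : ℝ) / (n + 1)) + μ.real (meshCell n j) -
          (diffCDF μ ν ((j : ℝ) / (n + 1)) - ν.real (meshCell n j)) =
          μ.real (meshCell n j) + ν.real (meshCell n j) by ring,
        ENNReal.ofReal_add measureReal_nonneg measureReal_nonneg, ofReal_measureReal,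
        ofReal_measureReal]
    rw [tsum_congr e, ENNReal.tsum_add, ← one_add_one_eq_two]
    exact add_le_add (tsum_measure_meshCell_le μ n) (tsum_measure_meshCell_le ν n)
  have hliminf : ∫⁻ h, liminf (fun n => g n h) atTop ≠ ∞ := by
    refine ne_top_of_le_ne_top (by simp : (2 : ℝ≥0∞) ≠ ∞) ?_
    refine (lintegral_liminf_le hgm).trans ?_
    exact liminf_le_of_frequently_le' (Frequently.of_forall hint)
  filter_upwards [ae_lt_top (Measurable.liminf hgm) hliminf] with h hh
  by_contra hinf
  refine hh.ne ?_
  refine ENNReal.eq_top_of_forall_nnreal_le fun r => ?_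
  obtain ⟨k, hk⟩ := exists_nat_ge r
  obtain ⟨T, hTL, hTk⟩ := Set.Infinite.exists_subset_card_eq hinf k
  refine le_trans (b := (k : ℝ≥0∞)) (by exact_mod_cast hk) ?_
  refine le_liminf_of_le (by isBoundedDefault) ?_
  filter_upwards [eventually_injOn_meshCell T] with n hn
  calc (k : ℝ≥0∞) = ∑ j ∈ T.image (fun x : ℝ => ⌈x * (n + 1)⌉ - 1), 1 := by
        rw [Finset.sum_const, Finset.card_image_of_injOn hn, hTk]; simp
    _ ≤ ∑ j ∈ T.image (fun x : ℝ => ⌈x * (n + 1)⌉ - 1), (J n j).indicator 1 h := by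
        refine Finset.sum_le_sum fun j hj => ?_
        obtain ⟨x, hx, rfl⟩ := Finset.mem_image.1 hj
        rw [indicator_of_mem, Pi.one_apply]
        exact mem_Icc_of_mem_levelSet_diffCDF (mem_meshCell_iff.2 (by ring)) (hTL hx)
    _ ≤ g n h := ENNReal.sum_le_tsum _

lemma ae_isRegularLevel_diffCDF (μ ν : Measure ℝ) [IsProbabilityMeasure μ]
    [IsProbabilityMeasure ν] : ∀ᵐ h, IsRegularLevel (diffCDF μ ν) h := by
  filter_upwards [ae_finite_levelSet_diffCDF μ ν,
    compl_mem_ae_iff.2 ((countable_oneSided (isCadlagVanishing_diffCDF μ ν)).measure_zero volume)]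
    with h h1 h2
  exact ⟨h1, fun x hx hos => h2 ⟨x, hx, hos⟩⟩

/-! ### Measures on the rightward routes -/

/-- The quadrants with rational corners that generate the Borel sets of the plane. -/
def ratQuadrants : Set (Set (ℝ × ℝ)) :=
  image2 (· ×ˢ ·) (⋃ a : ℚ, {Iic (a : ℝ)}) (⋃ b : ℚ, {Ioi (b : ℝ)})

lemma isPiSystem_ratQuadrants : IsPiSystem ratQuadrants :=
  Real.isPiSystem_Iic_rat.prod Real.isPiSystem_Ioi_rat

lemma generateFrom_ratQuadrants :
    (inferInstance : MeasurableSpace (ℝ × ℝ)) = .generateFrom ratQuadrants := by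
  symm
  refine generateFrom_eq_prod ?_ ?_ ?_ ?_
  · rw [← Real.borel_eq_generateFrom_Iic_rat]
    exact (BorelSpace.measurable_eq (α := ℝ)).symm
  · rw [← Real.borel_eq_generateFrom_Ioi_rat]
    exact (BorelSpace.measurable_eq (α := ℝ)).symm
  · refine ⟨fun n => Iic ((n : ℚ) : ℝ), fun n => mem_iUnion.2 ⟨n, rfl⟩, ?_⟩
    refine eq_univ_of_forall fun x => mem_iUnion.2 ?_
    obtain ⟨n, hn⟩ := exists_nat_ge x
    exact ⟨n, by rw [mem_Iic]; exact_mod_cast hn⟩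
  · refine ⟨fun n => Ioi ((-(n : ℚ) : ℚ) : ℝ), fun n => mem_iUnion.2 ⟨-n, rfl⟩, ?_⟩
    refine eq_univ_of_forall fun x => mem_iUnion.2 ?_
    obtain ⟨n, hn⟩ := exists_nat_gt (-x)
    exact ⟨n, by rw [mem_Ioi]; push_cast; linarith⟩

/-- The routes over the point `q`. -/
def routesOver (q : ℚ) : Set (ℝ × ℝ) := Iic (q : ℝ) ×ˢ Ioi (q : ℝ)

lemma measurableSet_routesOver (q : ℚ) : MeasurableSet (routesOver q) :=
  measurableSet_Iic.prod measurableSet_Ioi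

/-- The rightward routes. -/
def rightward : Set (ℝ × ℝ) := {z | z.1 < z.2}

lemma measurableSet_rightward : MeasurableSet rightward :=
  measurableSet_lt measurable_fst measurable_snd

lemma iUnion_routesOver : ⋃ q, routesOver q = rightward := by
  ext z
  rw [mem_iUnion]
  constructor
  · rintro ⟨q, h1, h2⟩
    exact lt_of_le_of_lt (mem_Iic.1 h1) (mem_Ioi.1 h2)
  · intro h
    obtain ⟨q, h1, h2⟩ := exists_rat_btwn (show z.1 < z.2 from h)
    exact ⟨q, h1.le, h2⟩

lemma exists_quadrant_inter_routesOver {A : Set (ℝ × ℝ)} (hA : A ∈ ratQuadrants) (q : ℚ) :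
    MeasurableSet A ∧ ∃ a b : ℚ, (a : ℝ) ≤ b ∧ A ∩ routesOver q = Iic (a : ℝ) ×ˢ Ioi (b : ℝ) := by
  obtain ⟨_, h1, _, h2, rfl⟩ := hA
  obtain ⟨a, rfl⟩ := mem_iUnion.1 h1
  obtain ⟨b, rfl⟩ := mem_iUnion.1 h2
  refine ⟨measurableSet_Iic.prod measurableSet_Ioi, min a q, max b q, ?_, ?_⟩
  · exact_mod_cast (min_le_right a q).trans (le_max_right b q)
  · rw [routesOver, prod_inter_prod, Iic_inter_Iic, Ioi_inter_Ioi]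
    push_cast
    rfl

/-- Measures that agree on the quadrants above the diagonal agree on the rightward routes. -/
lemma restrict_rightward_eq {α β : Measure (ℝ × ℝ)} [IsFiniteMeasure α]
    (h : ∀ a b : ℚ, (a : ℝ) ≤ b → α (Iic (a : ℝ) ×ˢ Ioi (b : ℝ)) = β (Iic (a : ℝ) ×ˢ Ioi (b : ℝ))) :
    α.restrict rightward = β.restrict rightward := by
  rw [← iUnion_routesOver, Measure.restrict_iUnion_congr]
  intro q
  refine ext_of_generate_finite _ generateFrom_ratQuadrants isPiSystem_ratQuadrants ?_ ?_
  · intro A hA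
    obtain ⟨hAm, a, b, hab, e⟩ := exists_quadrant_inter_routesOver hA q
    rw [Measure.restrict_apply hAm, Measure.restrict_apply hAm, e, h a b hab]
  · rw [Measure.restrict_apply_univ, Measure.restrict_apply_univ, routesOver, h q q le_rfl]

/-- A family of measures on the rightward routes is measurable if it is so on the quadrants above
the diagonal. -/
lemma measurable_of_measurable_quadrants {κ : ℝ → Measure (ℝ × ℝ)} [∀ h, IsFiniteMeasure (κ h)]
    (hκ : ∀ h, κ h rightwardᶜ = 0)
    (hm : ∀ a b : ℚ, (a : ℝ) ≤ b → Measurable fun h => κ h (Iic (a : ℝ) ×ˢ Ioi (b : ℝ))) :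
    Measurable κ := by
  have hq : ∀ q : ℚ, Measurable fun h => (κ h).restrict (routesOver q) := by
    intro q
    refine Measurable.measure_of_isPiSystem generateFrom_ratQuadrants isPiSystem_ratQuadrants ?_ ?_
    · intro A hA
      obtain ⟨hAm, a, b, hab, e⟩ := exists_quadrant_inter_routesOver hA q
      simp_rw [Measure.restrict_apply hAm, e]
      exact hm a b hab
    · simp_rw [Measure.restrict_apply_univ]
      exact hm q q le_rfl
  obtain ⟨f, hf⟩ := exists_surjective_nat ℚ
  have hD : ∀ n, MeasurableSet (disjointed (fun n => routesOver (f n)) n) :=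
    MeasurableSet.disjointed fun n => measurableSet_routesOver (f n)
  have hU : ⋃ n, disjointed (fun n => routesOver (f n)) n = rightward := by
    rw [iUnion_disjointed, ← iUnion_routesOver]
    exact hf.iUnion_comp routesOver
  refine Measure.measurable_of_measurable_coe _ fun A hA => ?_
  have e : ∀ h, κ h A = ∑' n, (κ h).restrict (routesOver (f n))
      (A ∩ disjointed (fun n => routesOver (f n)) n) := by
    intro h
    have h1 : κ h A = κ h (A ∩ rightward) := by
      rw [← measure_inter_add_sdiff A measurableSet_rightward,
        measure_mono_null (fun z hz => hz.2 : A \ rightward ⊆ rightwardᶜ) (hκ h), add_zero]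
    rw [h1, ← hU, inter_iUnion, measure_iUnion _ fun n => hA.inter (hD n)]
    · refine tsum_congr fun n => ?_
      rw [Measure.restrict_apply (hA.inter (hD n)), inter_assoc,
        inter_eq_left.2 (disjointed_subset _ n)]
    · exact fun m n hmn => (disjoint_disjointed _ hmn).mono inter_subset_right inter_subset_right
  simp_rw [e]
  exact Measurable.tsum fun n =>
    (Measure.measurable_coe (hA.inter (hD n))).comp (hq (f n))

/-! ### The rightward part of the excursion coupling -/

/-- The counting measure on the excursions above the height `h`. -/
noncomputable def excursionMeasure (F : ℝ → ℝ) (h : ℝ) : Measure (ℝ × ℝ) :=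
  Measure.count.restrict (excursionPairs F h)

lemma excursionMeasure_quadrant {F : ℝ → ℝ} (hF : IsCadlagVanishing F) {h : ℝ}
    (hh : IsRegularLevel F h) (h0 : 0 < h) {a b : ℝ} (hab : a ≤ b)
    (hbdd : BddBelow (F '' Icc a b)) (hne : h ≠ sInf (F '' Icc a b)) :
    excursionMeasure F h (Iic a ×ˢ Ioi b) = (Iio (sInf (F '' Icc a b))).indicator 1 h := by
  have hR : MeasurableSet (Iic a ×ˢ Ioi b) := measurableSet_Iic.prod measurableSet_Ioi
  rw [excursionMeasure, Measure.restrict_apply hR, Measure.count_apply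
    (hR.inter hh.finite_excursionPairs.measurableSet), inter_comm]
  rcases lt_or_gt_of_ne hne with hlt | hlt
  · rw [hh.encard_excursionPairs_inter hF h0 hab hbdd hlt, indicator_of_mem (mem_Iio.2 hlt)]
    simp
  · rw [hh.excursionPairs_inter_eq_empty hF h0 hab hlt,
      indicator_of_notMem (by rw [mem_Iio]; exact not_lt.2 hlt.le)]
    simp

lemma excursionMeasure_compl_rightward (F : ℝ → ℝ) (h : ℝ) :
    excursionMeasure F h rightwardᶜ = 0 := by
  rw [excursionMeasure, Measure.restrict_apply measurableSet_rightward.compl]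
  convert measure_empty (μ := (Measure.count : Measure (ℝ × ℝ)))
  rw [eq_empty_iff_forall_notMem]
  exact fun z hz => hz.1 (fst_lt_snd_of_mem_excursionPairs hz.2)

/-- The number of straddling excursions is undetermined when h equals the infimum; rational corners
leave only countably many such levels. -/
lemma ae_ne_sInf (F : ℝ → ℝ) :
    ∀ᵐ h, ∀ a b : ℚ, h ≠ sInf (F '' Icc (a : ℝ) b) := by
  refine ae_all_iff.2 fun a => ae_all_iff.2 fun b => ?_
  exact compl_mem_ae_iff.2 (measure_singleton _)

lemma aemeasurable_excursionMeasure (μ ν : Measure ℝ) [IsProbabilityMeasure μ]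
    [IsProbabilityMeasure ν] :
    AEMeasurable (excursionMeasure (diffCDF μ ν)) (volume.restrict (Ioi 0)) := by
  classical
  set F := diffCDF μ ν
  have hF : IsCadlagVanishing F := isCadlagVanishing_diffCDF μ ν
  have hgood : ∀ᵐ h, IsRegularLevel F h ∧ ∀ a b : ℚ, h ≠ sInf (F '' Icc (a : ℝ) b) :=
    (ae_isRegularLevel_diffCDF μ ν).and (ae_ne_sInf F)
  obtain ⟨B, hB, hBm, hB0⟩ := exists_measurable_superset_of_null (ae_iff.1 hgood)
  have hBgood : ∀ h ∉ B, IsRegularLevel F h ∧ ∀ a b : ℚ, h ≠ sInf (F '' Icc (a : ℝ) b) :=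
    fun h hh => by
      by_contra hn
      exact hh (hB hn)
  -- Once a measurable null set of bad levels is discarded, the mass of each quadrant above the
  -- diagonal is the indicator of a Borel set of levels.
  set κ : ℝ → Measure (ℝ × ℝ) := fun h => if h ∈ Bᶜ ∩ Ioi 0 then excursionMeasure F h else 0
    with hκ
  have hfin : ∀ h, IsFiniteMeasure (κ h) := by
    intro h
    by_cases hh : h ∈ Bᶜ ∩ Ioi 0
    · simp only [hκ, if_pos hh]
      refine ⟨?_⟩
      have hf := (hBgood h hh.1).1.finite_excursionPairs
      rw [excursionMeasure, Measure.restrict_apply_univ]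
      exact Measure.count_apply_lt_top.2 hf
    · simp only [hκ, if_neg hh]
      infer_instance
  refine ⟨κ, measurable_of_measurable_quadrants (fun h => ?_) (fun a b hab => ?_), ?_⟩
  · by_cases hh : h ∈ Bᶜ ∩ Ioi 0
    · simp only [hκ, if_pos hh]
      exact excursionMeasure_compl_rightward F h
    · simp only [hκ, if_neg hh]
      rfl
  · have e : (fun h => κ h (Iic (a : ℝ) ×ˢ Ioi (b : ℝ))) =
        (Bᶜ ∩ Ioi 0 ∩ Iio (sInf (F '' Icc (a : ℝ) b))).indicator 1 := by
      funext h
      by_cases hh : h ∈ Bᶜ ∩ Ioi 0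
      · simp only [hκ, if_pos hh]
        rw [excursionMeasure_quadrant hF (hBgood h hh.1).1 hh.2 hab
          (bddBelow_diffCDF_image μ ν _) ((hBgood h hh.1).2 a b), inter_indicator_one,
          Pi.mul_apply, indicator_of_mem hh, Pi.one_apply, one_mul]
      · simp only [hκ, if_neg hh]
        rw [indicator_of_notMem fun hm => hh hm.1]
        rfl
    rw [e]
    exact measurable_one.indicator ((hBm.compl.inter measurableSet_Ioi).inter measurableSet_Iio)
  · rw [EventuallyEq, ae_restrict_iff' measurableSet_Ioi]
    filter_upwards [compl_mem_ae_iff.2 hB0] with h hh h0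
    simp only [hκ]
    rw [if_pos ⟨hh, h0⟩]

/-- The rightward part of a laminar plan is the mixture of its excursions. -/
theorem measure_inter_rightward {μ ν : Measure ℝ} [IsProbabilityMeasure μ]
    [IsProbabilityMeasure ν] {π : Measure (ℝ × ℝ)} (hπ : π ∈ Marg μ ν) {S : Set (ℝ × ℝ)}
    (hS : π Sᶜ = 0) (h1 : NoOppositeOverlap S) (h2 : RightwardLaminar S) {A : Set (ℝ × ℝ)}
    (hA : MeasurableSet A) :
    π (A ∩ rightward) = ∫⁻ h in Ioi 0, excursionMeasure (diffCDF μ ν) h A := by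
  have := isProbabilityMeasure_of_mem_marg hπ
  have hae := aemeasurable_excursionMeasure μ ν
  set Γ := (volume.restrict (Ioi (0 : ℝ))).bind (excursionMeasure (diffCDF μ ν)) with hΓ
  have hΓA : ∀ {A}, MeasurableSet A → Γ A = ∫⁻ h in Ioi 0, excursionMeasure (diffCDF μ ν) h A :=
    fun hA => Measure.bind_apply hA hae
  have heq : π.restrict rightward = Γ.restrict rightward := by
    refine restrict_rightward_eq fun a b hab => ?_
    have hR : MeasurableSet (Iic (a : ℝ) ×ˢ Ioi (b : ℝ)) := measurableSet_Iic.prod measurableSet_Ioi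
    rw [hΓA hR, measure_Iic_prod_Ioi hπ hS h1 h2 hab]
    -- The mass becomes the length of the set of h > 0 below the infimum, which is the positive part
    -- of this infimum.
    have e : ∫⁻ h in Ioi 0, excursionMeasure (diffCDF μ ν) h (Iic (a : ℝ) ×ˢ Ioi (b : ℝ)) =
        ∫⁻ h in Ioi 0, (Iio (sInf (diffCDF μ ν '' Icc (a : ℝ) b))).indicator 1 h := by
      refine lintegral_congr_ae ?_
      rw [EventuallyEq, ae_restrict_iff' measurableSet_Ioi]
      filter_upwards [ae_isRegularLevel_diffCDF μ ν, ae_ne_sInf (diffCDF μ ν)] with h k1 k2 h0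
      exact excursionMeasure_quadrant (isCadlagVanishing_diffCDF μ ν) k1 h0 hab
        (bddBelow_diffCDF_image μ ν _) (k2 a b)
    rw [e, lintegral_indicator_one measurableSet_Iio, Measure.restrict_apply measurableSet_Iio,
      inter_comm, Ioi_inter_Iio, Real.volume_Ioo, sub_zero]
  have hcompl : Γ rightwardᶜ = 0 := by
    rw [hΓA measurableSet_rightward.compl]
    simp [excursionMeasure_compl_rightward]
  rw [← hΓA hA, ← Measure.restrict_apply hA, heq, Measure.restrict_apply hA,
    ← measure_inter_add_sdiff A measurableSet_rightward (μ := Γ),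
    measure_mono_null (fun z hz => hz.2 : A \ rightward ⊆ rightwardᶜ) hcompl, add_zero]

/-! ### Negative levels -/

lemma diffCDF_swap (μ ν : Measure ℝ) : diffCDF ν μ = fun t => -diffCDF μ ν t := by
  funext t
  simp only [diffCDF]
  ring

lemma IsCadlagVanishing.excursionPairs_neg {F : ℝ → ℝ} (hF : IsCadlagVanishing F) (h : ℝ) :
    excursionPairs (fun t => -F t) (-h) = excursionPairs F h := by
  simp only [excursionPairs, horizontalLine_inter, hF.levelSet_neg, prod_singleton_inj]

lemma encard_horizontalLine_inter (h : ℝ) (A : Set (ℝ × ℝ)) :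
    (horizontalLine h ∩ A).encard = {x | (x, h) ∈ A}.encard := by
  have e : horizontalLine h ∩ A = (fun x => (x, h)) '' {x | (x, h) ∈ A} := by
    ext ⟨x, k⟩
    constructor
    · rintro ⟨⟨-, hk⟩, hA⟩
      have hk' : k = h := hk
      subst hk'
      exact ⟨x, hA, rfl⟩
    · rintro ⟨x', hx', e⟩
      obtain ⟨rfl, rfl⟩ := Prod.mk.inj e
      exact ⟨⟨mem_univ _, rfl⟩, hx'⟩
  rw [e, Function.Injective.encard_image fun a b hab => (Prod.mk.inj hab).1]

lemma IsCadlagVanishing.decreasing_of_increasing {F : ℝ → ℝ} (hF : IsCadlagVanishing F) {x h : ℝ}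
    (hx : (x, h) ∈ increasingPoints F) : (x, -h) ∈ decreasingPoints fun t => -F t := by
  obtain ⟨hg, U, hU, hU'⟩ := hx
  refine ⟨(hF.mem_completedGraph_neg x h).2 hg, U, hU, ?_⟩
  rintro ⟨t, k⟩ hk ht
  have := hU' (t, -k) ((hF.mem_completedGraph_neg t (-k)).1 (by rwa [neg_neg])) ht
  simp only at this ⊢
  linarith

lemma IsCadlagVanishing.increasing_of_decreasing {F : ℝ → ℝ} (hF : IsCadlagVanishing F) {x h : ℝ}
    (hx : (x, h) ∈ decreasingPoints F) : (x, -h) ∈ increasingPoints fun t => -F t := by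
  obtain ⟨hg, U, hU, hU'⟩ := hx
  refine ⟨(hF.mem_completedGraph_neg x h).2 hg, U, hU, ?_⟩
  rintro ⟨t, k⟩ hk ht
  have := hU' (t, -k) ((hF.mem_completedGraph_neg t (-k)).1 (by rwa [neg_neg])) ht
  simp only at this ⊢
  linarith

lemma IsCadlagVanishing.crossingCount_neg {F : ℝ → ℝ} (hF : IsCadlagVanishing F) (h : ℝ) :
    crossingCount (fun t => -F t) (-h) = crossingCount F h := by
  have e1 : {x | (x, -h) ∈ increasingPoints fun t => -F t} = {x | (x, h) ∈ decreasingPoints F} := by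
    ext x
    refine ⟨fun hx => ?_, fun hx => hF.increasing_of_decreasing hx⟩
    simpa using hF.neg.decreasing_of_increasing hx
  have e2 : {x | (x, -h) ∈ decreasingPoints fun t => -F t} = {x | (x, h) ∈ increasingPoints F} := by
    ext x
    refine ⟨fun hx => ?_, fun hx => hF.decreasing_of_increasing hx⟩
    simpa using hF.neg.increasing_of_decreasing hx
  simp only [crossingCount, encard_horizontalLine_inter, e1, e2]
  rw [add_comm]

/-! ### Identification of the excursion coupling -/

/-- The counting measure on the routes attached to the height `h`. -/
noncomputable def routesMeasure (F : ℝ → ℝ) (h : ℝ) : Measure (ℝ × ℝ) :=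
  Measure.count.restrict (excursionRoutes F h)

lemma excursionRoutes_of_pos {F : ℝ → ℝ} {h : ℝ} (h0 : 0 < h) :
    excursionRoutes F h = excursionPairs F h := by
  ext z
  constructor
  · rintro (hz | hz)
    · exact hz.2
    · exact (lt_asymm h0 hz.1).elim
  · exact fun hz => Or.inl ⟨h0, hz⟩

lemma excursionRoutes_of_neg {F : ℝ → ℝ} {h : ℝ} (h0 : h < 0) :
    excursionRoutes F h = Prod.swap ⁻¹' excursionPairs F h := by
  ext z
  constructor
  · rintro (hz | hz)
    · exact (lt_asymm h0 hz.1).elim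
    · exact hz.2
  · exact fun hz => Or.inr ⟨h0, hz⟩

lemma count_map_swap :
    (Measure.count : Measure (ℝ × ℝ)).map Prod.swap = Measure.count := by
  ext A hA
  rw [Measure.map_apply measurable_swap hA, Measure.count_apply (measurable_swap hA),
    Measure.count_apply hA, ← image_swap_eq_preimage_swap,
    Prod.swap_injective.encard_image]

lemma routesMeasure_of_pos {F : ℝ → ℝ} {h : ℝ} (h0 : 0 < h) :
    routesMeasure F h = excursionMeasure F h := by
  rw [routesMeasure, excursionRoutes_of_pos h0, excursionMeasure]

lemma IsCadlagVanishing.routesMeasure_of_neg {F : ℝ → ℝ} (hF : IsCadlagVanishing F) {h : ℝ}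
    (h0 : h < 0) :
    routesMeasure F h = (excursionMeasure (fun t => -F t) (-h)).map Prod.swap := by
  rw [routesMeasure, excursionRoutes_of_neg h0, excursionMeasure, hF.excursionPairs_neg]
  conv_lhs => rw [← count_map_swap]
  exact MeasurableEquiv.restrict_map MeasurableEquiv.prodComm _ _

lemma IsRegularLevel.crossingCount_eq_routesMeasure {F : ℝ → ℝ} (hF : IsCadlagVanishing F) {h : ℝ}
    (hh : IsRegularLevel F h) (h0 : h ≠ 0) :
    crossingCount F h = 2 * routesMeasure F h univ ∧ routesMeasure F h univ ≠ ∞ := by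
  have key : ∀ {F : ℝ → ℝ} {h : ℝ}, IsCadlagVanishing F → IsRegularLevel F h → 0 < h →
      crossingCount F h = 2 * excursionMeasure F h univ ∧ excursionMeasure F h univ ≠ ∞ := by
    intro F h hF hh h0
    have hf := hh.finite_excursionPairs
    rw [hh.crossingCount_eq hF h0, excursionMeasure, Measure.restrict_apply_univ,
      Measure.count_apply hf.measurableSet]
    refine ⟨rfl, ?_⟩
    rw [← Measure.count_apply hf.measurableSet]
    exact (Measure.count_apply_lt_top.2 hf).ne
  rcases lt_or_gt_of_ne h0 with h1 | h1
  · rw [hF.routesMeasure_of_neg h1, Measure.map_apply measurable_swap MeasurableSet.univ,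
      preimage_univ, ← hF.crossingCount_neg]
    exact key hF.neg (hh.neg hF) (neg_pos.2 h1)
  · rw [routesMeasure_of_pos h1]
    exact key hF hh h1

lemma measurePreserving_neg_restrict :
    MeasurePreserving (fun h : ℝ => -h) (volume.restrict (Iio 0)) (volume.restrict (Ioi 0)) := by
  have := (Measure.measurePreserving_neg (volume : Measure ℝ)).restrict_preimage
    (measurableSet_Ioi (a := (0 : ℝ)))
  simpa using this

lemma volume_restrict_union : (volume : Measure ℝ).restrict (Iio 0 ∪ Ioi 0) = volume := by
  rw [Iio_union_Ioi]
  exact restrict_compl_singleton 0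

lemma aemeasurable_routesMeasure (μ ν : Measure ℝ) [IsProbabilityMeasure μ]
    [IsProbabilityMeasure ν] : AEMeasurable (routesMeasure (diffCDF μ ν)) volume := by
  have hF := isCadlagVanishing_diffCDF μ ν
  rw [← volume_restrict_union, aemeasurable_union_iff]
  constructor
  · have h1 : AEMeasurable (fun h => excursionMeasure (diffCDF ν μ) (-h))
        (volume.restrict (Iio 0)) :=
      (aemeasurable_excursionMeasure ν μ).comp_quasiMeasurePreserving
        measurePreserving_neg_restrict.quasiMeasurePreserving
    refine ((Measure.measurable_map Prod.swap measurable_swap).comp_aemeasurable h1).congr ?_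
    rw [EventuallyEq, ae_restrict_iff' measurableSet_Iio]
    refine Eventually.of_forall fun h h0 => ?_
    rw [hF.routesMeasure_of_neg h0, ← diffCDF_swap]
    rfl
  · refine (aemeasurable_excursionMeasure μ ν).congr ?_
    rw [EventuallyEq, ae_restrict_iff' measurableSet_Ioi]
    exact Eventually.of_forall fun h h0 => (routesMeasure_of_pos h0).symm

lemma uniformOn_excursionRoutes (F : ℝ → ℝ) (h : ℝ) :
    ProbabilityTheory.uniformOn (excursionRoutes F h) =
      (routesMeasure F h univ)⁻¹ • routesMeasure F h := by
  rw [routesMeasure, Measure.restrict_apply_univ]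
  rfl

lemma measurable_normalize :
    Measurable fun m : Measure (ℝ × ℝ) => (m univ)⁻¹ • m := by
  refine Measure.measurable_of_measurable_coe _ fun A hA => ?_
  simp only [Measure.smul_apply, smul_eq_mul]
  exact (Measure.measurable_coe MeasurableSet.univ).inv.mul (Measure.measurable_coe hA)

/-- The density of θ is twice the number of routes, which cancels both the factor 1/2 and the
normalization of the uniform law. What remains is the integral over h of the counting measures on
the routes. -/
lemma singularExcursionCoupling_apply (μ ν : Measure ℝ) [IsProbabilityMeasure μ]
    [IsProbabilityMeasure ν] {A : Set (ℝ × ℝ)} (hA : MeasurableSet A) :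
    singularExcursionCoupling μ ν A = ∫⁻ h, routesMeasure (diffCDF μ ν) h A := by
  have hF := isCadlagVanishing_diffCDF μ ν
  have hr := aemeasurable_routesMeasure μ ν
  have hu : AEMeasurable (fun h => ProbabilityTheory.uniformOn (excursionRoutes (diffCDF μ ν) h))
      volume := by
    simp_rw [uniformOn_excursionRoutes]
    exact measurable_normalize.comp_aemeasurable hr
  have hcc : ∀ᵐ h, crossingCount (diffCDF μ ν) h = 2 * routesMeasure (diffCDF μ ν) h univ ∧
      routesMeasure (diffCDF μ ν) h univ ≠ ∞ := by
    filter_upwards [ae_isRegularLevel_diffCDF μ ν, compl_mem_ae_iff.2 (measure_singleton (0 : ℝ))]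
      with h k1 k2
    exact k1.crossingCount_eq_routesMeasure hF k2
  have hcm : AEMeasurable (crossingCount (diffCDF μ ν)) volume := by
    have : AEMeasurable (fun h => 2 * routesMeasure (diffCDF μ ν) h univ) volume :=
      ((Measure.measurable_coe MeasurableSet.univ).comp_aemeasurable hr).const_mul 2
    exact this.congr (hcc.mono fun h hh => hh.1.symm)
  have huA : AEMeasurable (fun h => ProbabilityTheory.uniformOn
      (excursionRoutes (diffCDF μ ν) h) A) volume := (Measure.measurable_coe hA).comp_aemeasurable hu
  rw [singularExcursionCoupling, Measure.bind_apply hA, lintegral_smul_measure,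
    lintegral_withDensity_eq_lintegral_mul₀ hcm huA]
  · have e : ∫⁻ h, (crossingCount (diffCDF μ ν) * fun h =>
        ProbabilityTheory.uniformOn (excursionRoutes (diffCDF μ ν) h) A) h =
        ∫⁻ h, 2 * routesMeasure (diffCDF μ ν) h A := by
      refine lintegral_congr_ae ?_
      filter_upwards [hcc] with h hh
      rw [Pi.mul_apply, hh.1, uniformOn_excursionRoutes, Measure.smul_apply, smul_eq_mul, mul_assoc,
        ← mul_assoc (routesMeasure (diffCDF μ ν) h univ)]
      -- A level without routes contributes zero on both sides, despite the undefined uniform law.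
      by_cases h0 : routesMeasure (diffCDF μ ν) h univ = 0
      · rw [h0, measure_mono_null (subset_univ A) h0]
        simp
      · rw [ENNReal.mul_inv_cancel h0 hh.2, one_mul]
    rw [e, lintegral_const_mul' _ _ (by simp), smul_eq_mul, ← mul_assoc,
      ENNReal.inv_mul_cancel (by simp) (by simp), one_mul]
  · refine AEMeasurable.smul_measure (hu.mono_ac (withDensity_absolutelyContinuous _ _)) _

/-- A plan without fixed points that is concentrated on a set of arches as in the definition of
monotone plans is the excursion coupling of its marginals. -/
theorem eq_singularExcursionCoupling {μ ν : Measure ℝ} [IsProbabilityMeasure μ]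
    [IsProbabilityMeasure ν] {π : Measure (ℝ × ℝ)} (hπ : π ∈ Marg μ ν) {S : Set (ℝ × ℝ)}
    (hS : π Sᶜ = 0) (h1 : ArchesDoNotCross S) (h2 : ArchesDoNotConnect S)
    (h3 : NestedArchesSameOrientation S) (h4 : ∀ z ∈ S, z.1 ≠ z.2) :
    π = singularExcursionCoupling μ ν := by
  have hF := isCadlagVanishing_diffCDF μ ν
  have hopp := noOppositeOverlap_of_arches h1 h2 h3
  ext A hA
  have hπ' : π.map Prod.swap ∈ Marg ν μ :=
    ⟨by rw [Measure.map_map measurable_fst measurable_swap]; exact hπ.2,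
      by rw [Measure.map_map measurable_snd measurable_swap]; exact hπ.1⟩
  have hS' : π.map Prod.swap (Prod.swap ⁻¹' S)ᶜ = 0 := by
    change (π.map MeasurableEquiv.prodComm) _ = 0
    rw [MeasurableEquiv.map_apply]
    exact hS
  have e1 := measure_inter_rightward hπ hS hopp (rightwardLaminar_of_arches h1 h2) hA
  have e2 := measure_inter_rightward hπ' hS' hopp.swap (rightwardLaminar_swap_of_arches h1 h2)
    (measurable_swap hA)
  rw [Measure.map_apply measurable_swap ((measurable_swap hA).inter measurableSet_rightward)] at e2
  -- Without fixed points, every route is rightward or becomes so after the swap.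
  have hsplit : π A = π (Prod.swap ⁻¹' (Prod.swap ⁻¹' A ∩ rightward)) + π (A ∩ rightward) := by
    rw [← measure_union ?_ (hA.inter measurableSet_rightward)]
    · refine measure_congr ?_
      filter_upwards [compl_mem_ae_iff.2 hS] with z hz
      have hz' := h4 z (not_not.1 hz)
      refine propext ⟨fun hzA => ?_, fun hzA => hzA.elim (fun w => w.1) fun w => w.1⟩
      rcases lt_or_gt_of_ne hz' with h | h
      · exact Or.inr ⟨hzA, h⟩
      · exact Or.inl ⟨hzA, h⟩
    · exact Set.disjoint_left.2 fun z (hz : _ ∧ z.2 < z.1) (hz' : _ ∧ z.1 < z.2) =>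
        lt_asymm hz.2 hz'.2
  rw [hsplit, e1, e2, singularExcursionCoupling_apply μ ν hA]
  conv_rhs => rw [← volume_restrict_union]
  rw [Measure.restrict_union (Iio_disjoint_Ioi_same (a := (0 : ℝ))) measurableSet_Ioi, lintegral_add_measure]
  congr 1
  · rw [← measurePreserving_neg_restrict.lintegral_comp_emb
      (MeasurableEquiv.neg ℝ).measurableEmbedding]
    refine setLIntegral_congr_fun measurableSet_Iio fun h h0 => ?_
    rw [hF.routesMeasure_of_neg h0, ← diffCDF_swap, Measure.map_apply measurable_swap hA]
  · exact setLIntegral_congr_fun measurableSet_Ioi fun h h0 => by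
      rw [routesMeasure_of_pos h0]

/-! ### The equivalence -/

/-- The moving marginals are mutually singular because arches do not connect, so the mass on the
diagonal can serve as η. The rest, once normalized, is determined by `eq_singularExcursionCoupling`.
-/
theorem IsMonotonePlan.isExcursionCoupling {μ ν : Measure ℝ} [IsProbabilityMeasure μ]
    {π : Measure (ℝ × ℝ)} (hπ : π ∈ Marg μ ν) (h : IsMonotonePlan π) :
    IsExcursionCoupling μ ν π := by
  have := isProbabilityMeasure_of_mem_marg hπ
  obtain ⟨S, hS, h1, h2, h3⟩ := h
  obtain ⟨hμ, hν⟩ := marg_decomposition hπ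
  refine ⟨_, _, _, hμ, hν, mutuallySingular_of_archesDoNotConnect hS h2, ?_⟩
  rw [map_diag_eq_restrict]
  have hμ₀ : ((π.restrict movingRoutes).map Prod.fst) univ = π movingRoutes := by
    rw [Measure.map_apply measurable_fst MeasurableSet.univ, preimage_univ,
      Measure.restrict_apply_univ]
  have hν₀ : ((π.restrict movingRoutes).map Prod.snd) univ = π movingRoutes := by
    rw [Measure.map_apply measurable_snd MeasurableSet.univ, preimage_univ,
      Measure.restrict_apply_univ]
  rw [hμ₀, hν₀]
  conv_lhs => rw [← Measure.restrict_compl_add_restrict (μ := π) measurableSet_movingRoutes]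
  congr 1
  -- Without moving mass, the normalized singular parts are meaningless, but their coupling is
  -- multiplied by 0.
  by_cases hm : π movingRoutes = 0
  · rw [hm, zero_smul, Measure.restrict_eq_zero.2 hm]
  · have hm' : π movingRoutes ≠ ∞ := measure_ne_top _ _
    set ρ := (π movingRoutes)⁻¹ • π.restrict movingRoutes with hρ
    have hρ1 : ρ.map Prod.fst = (π movingRoutes)⁻¹ • (π.restrict movingRoutes).map Prod.fst :=
      Measure.map_smul _ _ _
    have hρ2 : ρ.map Prod.snd = (π movingRoutes)⁻¹ • (π.restrict movingRoutes).map Prod.snd :=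
      Measure.map_smul _ _ _
    have hp1 : IsProbabilityMeasure
        ((π movingRoutes)⁻¹ • (π.restrict movingRoutes).map Prod.fst) := by
      refine ⟨?_⟩
      rw [Measure.smul_apply, hμ₀, smul_eq_mul, ENNReal.inv_mul_cancel hm hm']
    have hp2 : IsProbabilityMeasure
        ((π movingRoutes)⁻¹ • (π.restrict movingRoutes).map Prod.snd) := by
      refine ⟨?_⟩
      rw [Measure.smul_apply, hν₀, smul_eq_mul, ENNReal.inv_mul_cancel hm hm']
    have hρS : ρ (S ∩ movingRoutes)ᶜ = 0 := by
      rw [hρ, Measure.smul_apply, smul_eq_mul, compl_inter]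
      rw [measure_union_null (Measure.restrict_le_self.absolutelyContinuous hS)
        (by rw [Measure.restrict_apply measurableSet_movingRoutes.compl, compl_inter_self,
          measure_empty]), mul_zero]
    rw [← eq_singularExcursionCoupling (π := ρ) ⟨hρ1, hρ2⟩ hρS
      (fun x y x' y' h h' => h1 x y x' y' h.1 h'.1) (fun x y x' y' h h' => h2 x y x' y' h.1 h'.1)
      (fun x y x' y' h h' => h3 x y x' y' h.1 h'.1) fun z hz => hz.2, hρ, smul_smul,
      ENNReal.mul_inv_cancel hm hm', one_smul]

lemma IsExcursionCoupling.unique {μ ν : Measure ℝ} [IsFiniteMeasure μ] [IsFiniteMeasure ν]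
    {π π' : Measure (ℝ × ℝ)} (h : IsExcursionCoupling μ ν π) (h' : IsExcursionCoupling μ ν π') :
    π = π' := by
  obtain ⟨η, μ₀, ν₀, e1, e2, hs, rfl⟩ := h
  obtain ⟨η', μ₀', ν₀', e1', e2', hs', rfl⟩ := h'
  have f1 : IsFiniteMeasure η := isFiniteMeasure_of_le μ (e1 ▸ Measure.le_add_right le_rfl)
  have f2 : IsFiniteMeasure μ₀ := isFiniteMeasure_of_le μ (e1 ▸ Measure.le_add_left le_rfl)
  have f3 : IsFiniteMeasure ν₀ := isFiniteMeasure_of_le ν (e2 ▸ Measure.le_add_left le_rfl)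
  have f1' : IsFiniteMeasure η' := isFiniteMeasure_of_le μ (e1' ▸ Measure.le_add_right le_rfl)
  have f2' : IsFiniteMeasure μ₀' := isFiniteMeasure_of_le μ (e1' ▸ Measure.le_add_left le_rfl)
  have f3' : IsFiniteMeasure ν₀' := isFiniteMeasure_of_le ν (e2' ▸ Measure.le_add_left le_rfl)
  obtain ⟨rfl, rfl, rfl⟩ :=
    singular_decomposition_unique (e1.symm.trans e1') (e2.symm.trans e2') hs hs'
  rfl

theorem mainTheorem1 (μ ν : Measure ℝ) [IsProbabilityMeasure μ] [IsProbabilityMeasure ν]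
    (hμ : Integrable (fun x : ℝ => |x|) μ) (hν : Integrable (fun x : ℝ => |x|) ν)
    (q : ℝ) (hq : q ∈ Ioo (0 : ℝ) 1) :
    (∀ π : ProbabilityMeasure (ℝ × ℝ), (π : Measure (ℝ × ℝ)) ∈ Marg μ ν →
      List.TFAE [
        IsLimitSolution μ ν π,
        IsSecondarySolution q μ ν (π : Measure (ℝ × ℝ)),
        IsMonotonePlan (π : Measure (ℝ × ℝ)),
        IsExcursionCoupling μ ν (π : Measure (ℝ × ℝ))]) ∧
    (∃! π : ProbabilityMeasure (ℝ × ℝ), (π : Measure (ℝ × ℝ)) ∈ Marg μ ν ∧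
      IsExcursionCoupling μ ν (π : Measure (ℝ × ℝ))) := by
  obtain ⟨π₁, hπ₁, hlim⟩ := exists_isLimitSolution (μ := μ) (ν := ν)
  obtain ⟨π₂, hsec⟩ := exists_isSecondarySolution (μ := μ) (ν := ν) hq.1
  have hexc₁ : IsExcursionCoupling μ ν (π₁ : Measure (ℝ × ℝ)) :=
    (hlim.isMonotonePlan hμ hν hπ₁).isExcursionCoupling hπ₁
  have hexc₂ : IsExcursionCoupling μ ν (π₂ : Measure (ℝ × ℝ)) :=
    (hsec.isMonotonePlan hμ hν hq).isExcursionCoupling hsec.1.1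
  refine ⟨fun π hπ => ?_, π₁, ⟨hπ₁, hexc₁⟩, fun π hπ => Subtype.ext (hπ.2.unique hexc₁)⟩
  tfae_have 1 → 3 := fun h => h.isMonotonePlan hμ hν hπ
  tfae_have 2 → 3 := fun h => h.isMonotonePlan hμ hν hq
  tfae_have 3 → 4 := fun h => h.isExcursionCoupling hπ
  -- By uniqueness π is the limit solution obtained by compactness.
  tfae_have 4 → 1 := fun h => by
    have e : π = π₁ := Subtype.ext (h.unique hexc₁)
    rwa [e]
  tfae_have 4 → 2 := fun h => by
    rw [h.unique hexc₂]
    exact hsec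
  tfae_finish
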